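/- **Definitions.** A *precubical set* is a graded set $X=(X_n)_{n\ge 0}$ with face maps $\delta_k^\nu:X_n\to X_{n-1}$ ($1\le k\le n$, $\nu\in\{0,1\}$; lower faces for $\nu=0$, upper faces for $\nu=1$) such that $\delta_k^\nu\delta_\ell^\mu=\delta_{\ell-1}^\mu\delta_k^\nu$ for $k<\ell$. A *higher-dimensional automaton* (HDA) is a precubical set with a distinguished $0$-cube $i\in X_0$; morphisms are graded maps that commute with all faces and preserve the distinguished point. A (pointed) *cube path* in $X$ is a sequence $(x_1,\dots,x_m)$ with $x_1=i$ such that for each $j<m$ either $x_j=\delta_k^0x_{j+1}$ (an event is started) or $x_{j+1}=\delta_k^1x_j$ (an event is finished) for some $k$; the index $k$ of each step is part of the path. Two cube paths are *adjacent at position $p$* if they agree except for the cube at position $p$ and the two steps around it, and, for some $k<\ell$, up to exchanging the two paths $(x_j)$ and $(y_j)$, one of the following holds: * $x_{p-1}=\delta_k^0x_p$, $x_p=\delta_\ell^0x_{p+1}$ and $y_{p-1}=\delta_{\ell-1}^0y_p$, $y_p=\delta_k^0y_{p+1}$; * $x_p=\delta_\ell^1x_{p-1}$, $x_{p+1}=\delta_k^1x_p$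 and $y_p=\delta_k^1y_{p-1}$, $y_{p+1}=\delta_{\ell-1}^1y_p$; * $x_p=\delta_{\ell-1}^1x_{p-1}$, $x_p=\delta_k^0x_{p+1}$ and $y_{p-1}=\delta_k^0y_p$, $y_{p+1}=\delta_\ell^1y_p$; * $x_p=\delta_k^1x_{p-1}$, $x_p=\delta_{\ell-1}^0x_{p+1}$ and $y_{p-1}=\delta_\ell^0y_p$, $y_{p+1}=\delta_k^1y_p$. *Homotopy* $\sim$ is the reflexive transitive closure of adjacency. The *unfolding* $\tilde X$ of $X$ is the HDA whose $n$-cubes are the homotopy classes of cube paths ending in an $n$-cube, pointed by $[i]$, with $\tilde\delta_k^1[x_1,\dots,x_m]=[x_1,\dots,x_m,\delta_k^1x_m]$ and $\tilde\delta_k^0[x_1,\dots,x_m]$ the class of all cube paths to $\delta^0_kx_m$ whose extension by the step (of index $k$) to $x_m$ is homotopic to $(x_1,\dots,x_m)$. A morphism $f:X\to Y$ induces $\tilde f:\tilde X\to\tilde Y$. The category $\mathsf{HDA_h}$ has HDA as objects and HDA-morphisms $\tilde X\to\tilde Y$ as morphisms $X\to Y$. A *path object* is an HDA freely generated by a cube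 path (so that morphisms out of it are the cube paths of the same shape). The category $\mathsf{HDP}$ has path objects as objects, and its morphisms are generated by isomorphisms and by *path extensions*, i.e. the morphisms that send the generating path of the source to a prefix of that of the target. A morphism of $\mathsf{HDA_h}$ is *open* if it has the right lifting property in $\mathsf{HDA_h}$ with respect to all $\tilde g$, $g\in\mathsf{HDP}$. Let $\Sigma$ be a linearly ordered alphabet and $!\Sigma$ the HDA whose $n$-cubes are the weakly increasing sequences $(a_1,\dots,a_n)$ in $\Sigma$, with both $\delta_k^0$ and $\delta_k^1$ omitting the $k$-th entry. A *labelled HDA* is an HDA $X$ with a morphism $\lambda:X\to{!\Sigma}$. Labelled HDA $X,Y$ are *homotopy bisimilar* if there are a labelled HDA $Z$ and open morphisms $X\leftarrow Z\to Y$ in $\mathsf{HDA_h}$ that commute with the labellings $\tilde\lambda$ of the unfoldings. The *split trace* of a cube path lists, step by step, the label of the event that is started or finished, and whether it is started or finished; the *ST-trace* moreover records, for each finished event, at which step it was started. $X$ and $Y$ are *split bisimilar* (resp. *ST-bisimilar*) if there is a relation $R$ between cube paths of $X$ and of $Y$ that relates the paths consisting of the initial point only, relates only paths with equal split traces (resp.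 ST-traces), and such that whenever $\rho\mathrel R\sigma$, every one-step extension $\rho'$ of $\rho$ is matched by a one-step extension $\sigma'$ of $\sigma$ with $\rho'\mathrel R\sigma'$, and conversely. They are *history-preserving bisimilar* if there is such an ST-bisimulation $R$ in which moreover, whenever $\rho\mathrel R\sigma$, every $\rho'$ adjacent to $\rho$ at a position $p$ is matched by a $\sigma'$ adjacent to $\sigma$ at $p$ with $\rho'\mathrel R\sigma'$, and conversely. **Examples**, over $\Sigma=\{a<b<c<d<e\}$. All are of dimension $\le 2$ with initial state $x_0$. We write $y_k:i\xrightarrow{\alpha}j$ for an edge from $x_i$ to $x_j$ labelled $\alpha$, and $(p,q;p',q')$ for a square with $\delta_2^0=y_p$, $\delta_1^0=y_q$, $\delta_2^1=y_{p'}$, $\delta_1^1=y_{q'}$. * $X_1$: $y_1:0\xrightarrow a1$, $y_2:0\xrightarrow b2$, $y_3:1\xrightarrow b3$, $y_4:1\xrightarrow b4$, $y_5:2\xrightarrow a4$, square $(1,2;5,4)$. $X_1'$: $X_1$ without $x_3$ and $y_3$. * $X_2$: $y_1:0\xrightarrow c1$, $y_2:0\xrightarrow b2$, $y_3:0\xrightarrow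 a3$, $y_4:1\xrightarrow b4$, $y_5:2\xrightarrow c4$, $y_6:2\xrightarrow a5$, $y_7:3\xrightarrow b5$, $y_8:0\xrightarrow c6$, $y_9:0\xrightarrow a7$, $y_{10}:0\xrightarrow b8$, $y_{11}:6\xrightarrow a9$, $y_{12}:7\xrightarrow c9$, $y_{13}:7\xrightarrow b10$, $y_{14}:8\xrightarrow a10$, $y_{15}:0\xrightarrow a11$, $y_{16}:0\xrightarrow b12$, $y_{17}:11\xrightarrow b13$, $y_{18}:12\xrightarrow a13$, squares $(2,1;4,5)$, $(3,2;6,7)$, $(9,8;11,12)$, $(9,10;14,13)$, $(15,16;18,17)$. $X_2'$: $X_2$ without the last square, $y_{15},\dots,y_{18}$ and $x_{11},x_{12},x_{13}$. * $X_3$: $y_1:0\xrightarrow a1$, $y_2:0\xrightarrow b2$, $y_3:1\xrightarrow c3$, $y_4:1\xrightarrow b4$, $y_5:2\xrightarrow a4$, $y_6:2\xrightarrow c5$, $y_7:3\xrightarrow b6$, $y_8:4\xrightarrow c6$, $y_9:4\xrightarrow c7$, $y_{10}:5\xrightarrow a7$, $y_{11}:6\xrightarrow d8$, $y_{12}:6\xrightarrow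 c9$, $y_{13}:7\xrightarrow c9$, $y_{14}:7\xrightarrow e10$, $y_{15}:8\xrightarrow c11$, $y_{16}:9\xrightarrow d11$, $y_{17}:9\xrightarrow e12$, $y_{18}:10\xrightarrow c12$, $y_{19}:11\xrightarrow e13$, $y_{20}:12\xrightarrow d13$, $y_{21}:6\xrightarrow e14$, $y_{22}:6\xrightarrow c15$, $y_{23}:14\xrightarrow c16$, $y_{24}:15\xrightarrow e16$, $y_{25}:15\xrightarrow d17$, $y_{26}:16\xrightarrow d18$, $y_{27}:17\xrightarrow e18$, $y_{28}:7\xrightarrow d19$, $y_{29}:7\xrightarrow c20$, $y_{30}:19\xrightarrow c21$, $y_{31}:20\xrightarrow d21$, $y_{32}:20\xrightarrow e22$, $y_{33}:21\xrightarrow e23$, $y_{34}:22\xrightarrow d23$, squares $(1,2;5,4)$, $(4,3;7,8)$, $(5,6;10,9)$, $(8,9;13,12)$, $(12,11;15,16)$, $(13,14;18,17)$, $(16,17;20,19)$, $(22,21;23,24)$, $(25,24;26,27)$, $(29,28;30,31)$, $(31,32;34,33)$. $X_3'$: $X_3$ with the labels $d$ and $e$ exchanged throughout (and, in the squares whose edges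 are labelled $d$ and $e$, i.e. the seventh, ninth and eleventh square, the two directions exchanged so that labels are increasing). **Theorem.** Neither ST-bisimilarity nor split bisimilarity implies homotopy bisimilarity. Homotopy bisimilarity and history-preserving bisimilarity are incomparable: neither implies the other. More precisely: 1. $X_1$ and $X_1'$ are homotopy bisimilar and ST-bisimilar, but not history-preserving bisimilar. 2. $X_2$ and $X_2'$ are history-preserving bisimilar, hence also ST-bisimilar and split bisimilar, but not homotopy bisimilar. 3. $X_3$ and $X_3'$ are split bisimilar, but neither ST-bisimilar nor homotopy bisimilar. -/

import Mathlib

open CategoryTheory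

universe u

/-! ### Precubical sets and higher-dimensional automata -/

/-- A precubical set. The face map `δ k ν` on `(n+1)`-cubes is indexed by `k : Fin (n + 1)` (directions
are counted from `0`); `ν = false` gives lower faces and `ν = true` gives upper faces. With `l + 1`
in the role of the larger index, `δ_δ` is the usual `δ_k^ν δ_{l+1}^μ = δ_l^μ δ_k^ν` for `k < l + 1`. -/
structure PrecubicalSet : Type (u + 1) where
  cell : ℕ → Type u
  δ : ∀ {n : ℕ}, Fin (n + 1) → Bool → cell (n + 1) → cell n
  δ_δ : ∀ {n : ℕ} (k l : Fin (n + 1)) (ν μ : Bool) (x : cell (n + 2)), k ≤ l →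
    δ k ν (δ l.succ μ x) = δ l μ (δ k.castSucc ν x)

/-- A higher-dimensional automaton: a precubical set with a distinguished `0`-cube. -/
structure HDA : Type (u + 1) extends PrecubicalSet.{u} where
  pt : cell 0

namespace HDA

/-- Pointed precubical morphisms. -/
@[ext]
structure Hom (X Y : HDA.{u}) : Type u where
  map : ∀ {n : ℕ}, X.cell n → Y.cell n
  map_δ : ∀ {n : ℕ} (k : Fin (n + 1)) (ν : Bool) (x : X.cell (n + 1)),
    map (X.δ k ν x) = Y.δ k ν (map x)
  map_pt : map X.pt = Y.pt

instance : Category.{u} HDA.{u} where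
  Hom X Y := Hom X Y
  id X := ⟨fun x => x, fun _ _ _ => rfl, rfl⟩
  comp f g := ⟨fun x => g.map (f.map x), fun k ν x => by rw [f.map_δ, g.map_δ], by
    rw [f.map_pt, g.map_pt]⟩

/-- Both cases of the precubical identity at once. -/
theorem δ_δ' (X : HDA.{u}) {n : ℕ} (l : Fin (n + 2)) (k : Fin (n + 1)) (ν μ : Bool)
    (x : X.cell (n + 2)) :
    X.δ k ν (X.δ l μ x) = X.δ (k.predAbove l) μ (X.δ (l.succAbove k) ν x) := by
  rcases lt_or_ge k.castSucc l with h | h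
  · obtain ⟨j, rfl⟩ := Fin.exists_succ_eq.2 (Fin.ne_zero_of_lt h)
    rw [Fin.succAbove_of_castSucc_lt _ _ h, Fin.predAbove_of_castSucc_lt _ _ h, Fin.pred_succ]
    exact X.δ_δ k j ν μ x (Fin.castSucc_lt_succ_iff.1 h)
  · have hl : l ≠ Fin.last _ := ne_of_lt (lt_of_le_of_lt h (Fin.castSucc_lt_last k))
    obtain ⟨j, rfl⟩ := Fin.exists_castSucc_eq.2 hl
    rw [Fin.succAbove_of_le_castSucc _ _ h, Fin.predAbove_of_le_castSucc _ _ h,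
      Fin.castPred_castSucc]
    exact (X.δ_δ j k μ ν x (by simpa using h)).symm

/-! ### Cube paths and homotopy -/

/-- Pointed cube paths to a given cube, that is, sequences of cubes starting with the point, in
which each cube is a lower face of the next one (`start`: the next one has one more running event)
or the next one is an upper face of it (`finish`). The index of the face is part of the path, so that
cube paths of a given shape are the same as morphisms from a path object. -/
inductive CubePath (X : HDA.{u}) : ∀ n : ℕ, X.cell n → Type u
  | nil : CubePath X 0 X.pt
  | start {n : ℕ} {x : X.cell n} (ρ : CubePath X n x) (k : Fin (n + 1)) (y : X.cell (n + 1))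
      (h : X.δ k false y = x) : CubePath X (n + 1) y
  | finish {n : ℕ} {y : X.cell (n + 1)} (ρ : CubePath X (n + 1) y) (k : Fin (n + 1)) (x : X.cell n)
      (h : X.δ k true y = x) : CubePath X n x

namespace CubePath

variable {X Y : HDA.{u}}

/-- The number of steps. -/
def length : ∀ {n : ℕ} {x : X.cell n}, CubePath X n x → ℕ
  | _, _, nil => 0
  | _, _, start ρ _ _ _ => ρ.length + 1
  | _, _, finish ρ _ _ _ => ρ.length + 1

/-- The sequence of steps, each given by its kind (`true` for `finish`) and its index. -/
def shape : ∀ {n : ℕ} {x : X.cell n}, CubePath X n x → List (Bool × ℕ)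
  | _, _, nil => []
  | _, _, start ρ k _ _ => ρ.shape ++ [(false, (k : ℕ))]
  | _, _, finish ρ k _ _ => ρ.shape ++ [(true, (k : ℕ))]

/-- The image of a cube path under a morphism. -/
def map (f : X ⟶ Y) : ∀ {n : ℕ} {x : X.cell n}, CubePath X n x → CubePath Y n (f.map x)
  | _, _, nil => (Hom.map_pt f).symm ▸ nil
  | _, _, start ρ k y h => start (map f ρ) k (f.map y) (by rw [← Hom.map_δ f, h])
  | _, _, finish ρ k x h => finish (map f ρ) k (f.map x) (by rw [← Hom.map_δ f, h])

/-- One direction of the adjacency relation: the two paths agree except for the cube reached after `p + 1`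
steps, and the two steps around it are replaced according to the precubical identity. -/
inductive AdjOneWay : ∀ (_p : ℕ) {n : ℕ} {x : X.cell n}, CubePath X n x → CubePath X n x → Prop
  | startStart {n : ℕ} {w : X.cell n} (ρ : CubePath X n w) (k l : Fin (n + 1)) (hkl : k ≤ l)
      (x y : X.cell (n + 1)) (z : X.cell (n + 2)) (h₁ h₂ h₃ h₄) :
      AdjOneWay ρ.length ((ρ.start k x h₁).start l.succ z h₂)
        ((ρ.start l y h₃).start k.castSucc z h₄)
  | finishFinish {n : ℕ} {w : X.cell (n + 2)} (ρ : CubePath X (n + 2) w) (k l : Fin (n + 1))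
      (hkl : k ≤ l) (x y : X.cell (n + 1)) (z : X.cell n) (h₁ h₂ h₃ h₄) :
      AdjOneWay ρ.length ((ρ.finish l.succ x h₁).finish k z h₂)
        ((ρ.finish k.castSucc y h₃).finish l z h₄)
  | startFinish {n : ℕ} {w : X.cell (n + 1)} (ρ : CubePath X (n + 1) w) (k l : Fin (n + 1))
      (hkl : k ≤ l) (x : X.cell n) (y : X.cell (n + 2)) (z : X.cell (n + 1)) (h₁ h₂ h₃ h₄) :
      AdjOneWay ρ.length ((ρ.finish l x h₁).start k z h₂)
        ((ρ.start k.castSucc y h₃).finish l.succ z h₄)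
  | startFinish' {n : ℕ} {w : X.cell (n + 1)} (ρ : CubePath X (n + 1) w) (k l : Fin (n + 1))
      (hkl : k ≤ l) (x : X.cell n) (y : X.cell (n + 2)) (z : X.cell (n + 1)) (h₁ h₂ h₃ h₄) :
      AdjOneWay ρ.length ((ρ.finish k x h₁).start l z h₂)
        ((ρ.start l.succ y h₃).finish k.castSucc z h₄)
  | congrStart {p n : ℕ} {w : X.cell n} {ρ σ : CubePath X n w} (hρ : AdjOneWay p ρ σ)
      (k : Fin (n + 1)) (x : X.cell (n + 1)) (h) : AdjOneWay p (ρ.start k x h) (σ.start k x h)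
  | congrFinish {p n : ℕ} {w : X.cell (n + 1)} {ρ σ : CubePath X (n + 1) w}
      (hρ : AdjOneWay p ρ σ) (k : Fin (n + 1)) (x : X.cell n) (h) :
      AdjOneWay p (ρ.finish k x h) (σ.finish k x h)

/-- Adjacency at position `p`. -/
def AdjAt (p : ℕ) {n : ℕ} {x : X.cell n} (ρ σ : CubePath X n x) : Prop :=
  AdjOneWay p ρ σ ∨ AdjOneWay p σ ρ

/-- Adjacency. -/
def Adj {n : ℕ} {x : X.cell n} (ρ σ : CubePath X n x) : Prop :=
  ∃ p, AdjAt p ρ σ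

/-- Homotopy: the reflexive, transitive closure of adjacency. -/
def Homotopic {n : ℕ} {x : X.cell n} (ρ σ : CubePath X n x) : Prop :=
  Relation.ReflTransGen Adj ρ σ

theorem Adj.symm {n : ℕ} {x : X.cell n} {ρ σ : CubePath X n x} (h : Adj ρ σ) : Adj σ ρ := by
  obtain ⟨p, h⟩ := h
  exact ⟨p, h.symm⟩

theorem Adj.homotopic {n : ℕ} {x : X.cell n} {ρ σ : CubePath X n x} (h : Adj ρ σ) :
    Homotopic ρ σ := .single h

theorem Homotopic.symm {n : ℕ} {x : X.cell n} {ρ σ : CubePath X n x} (h : Homotopic ρ σ) :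
    Homotopic σ ρ := by
  induction h with
  | refl => exact .refl
  | tail _ h ih => exact (Adj.homotopic h.symm).trans ih

/-- Homotopy as a setoid. -/
def homotopySetoid (X : HDA.{u}) (n : ℕ) (x : X.cell n) : Setoid (CubePath X n x) where
  r := Homotopic
  iseqv := ⟨fun _ => .refl, Homotopic.symm, Relation.ReflTransGen.trans⟩

theorem Homotopic.lift {n m : ℕ} {x : X.cell n} {y : Y.cell m} (F : CubePath X n x → CubePath Y m y)
    (hF : ∀ p ρ σ, AdjOneWay p ρ σ → Homotopic (F ρ) (F σ)) {ρ σ : CubePath X n x}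
    (h : Homotopic ρ σ) : Homotopic (F ρ) (F σ) := by
  induction h with
  | refl => exact .refl
  | tail _ h ih =>
    obtain ⟨p, h | h⟩ := h
    · exact ih.trans (hF _ _ _ h)
    · exact ih.trans (hF _ _ _ h).symm

theorem Homotopic.start {n : ℕ} {x : X.cell n} {ρ σ : CubePath X n x} (h : Homotopic ρ σ)
    (k : Fin (n + 1)) (y : X.cell (n + 1)) (hy : X.δ k false y = x) :
    Homotopic (ρ.start k y hy) (σ.start k y hy) :=
  h.lift (fun τ => τ.start k y hy) fun p _ _ h => Adj.homotopic ⟨p, .inl (h.congrStart k y hy)⟩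

theorem Homotopic.finish {n : ℕ} {y : X.cell (n + 1)} {ρ σ : CubePath X (n + 1) y}
    (h : Homotopic ρ σ) (k : Fin (n + 1)) (x : X.cell n) (hx : X.δ k true y = x) :
    Homotopic (ρ.finish k x hx) (σ.finish k x hx) :=
  h.lift (fun τ => τ.finish k x hx) fun p _ _ h => Adj.homotopic ⟨p, .inl (h.congrFinish k x hx)⟩

theorem Homotopic.map (f : X ⟶ Y) {n : ℕ} {x : X.cell n} {ρ σ : CubePath X n x}
    (h : Homotopic ρ σ) : Homotopic (ρ.map f) (σ.map f) := by
  refine h.lift (CubePath.map f) fun p ρ σ h => ?_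
  clear * - h
  induction h with
  | startStart ρ k l hkl => exact Adj.homotopic ⟨_, .inl (.startStart (ρ.map f) k l hkl ..)⟩
  | finishFinish ρ k l hkl => exact Adj.homotopic ⟨_, .inl (.finishFinish (ρ.map f) k l hkl ..)⟩
  | startFinish ρ k l hkl x y =>
    exact Adj.homotopic ⟨_, .inl (.startFinish (ρ.map f) k l hkl _ (f.map y) ..)⟩
  | startFinish' ρ k l hkl x y =>
    exact Adj.homotopic ⟨_, .inl (.startFinish' (ρ.map f) k l hkl _ (f.map y) ..)⟩
  | congrStart _ k x h ih => exact ih.start k _ _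
  | congrFinish _ k x h ih => exact ih.finish k _ _

/-- The two adjacencies of two consecutive `start` steps at once. -/
theorem homotopic_startStart {n : ℕ} {w : X.cell n} (ρ : CubePath X n w) (k k' : Fin (n + 1))
    (l l' : Fin (n + 2)) (hk : k' = k.predAbove l) (hl : l' = l.succAbove k)
    (x y : X.cell (n + 1)) (z : X.cell (n + 2)) (h₁ h₂ h₃ h₄) :
    Homotopic ((ρ.start k x h₁).start l z h₂) ((ρ.start k' y h₃).start l' z h₄) := by
  rcases lt_or_ge k.castSucc l with h | h
  · obtain ⟨j, rfl⟩ := Fin.exists_succ_eq.2 (Fin.ne_zero_of_lt h)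
    rw [Fin.succAbove_of_castSucc_lt _ _ h] at hl
    rw [Fin.predAbove_of_castSucc_lt _ _ h, Fin.pred_succ] at hk
    subst hl hk
    exact Adj.homotopic ⟨_, .inl (.startStart ρ k k' (Fin.castSucc_lt_succ_iff.1 h) ..)⟩
  · have hl' : l ≠ Fin.last _ := ne_of_lt (lt_of_le_of_lt h (Fin.castSucc_lt_last k))
    obtain ⟨j, rfl⟩ := Fin.exists_castSucc_eq.2 hl'
    rw [Fin.succAbove_of_le_castSucc _ _ h] at hl
    rw [Fin.predAbove_of_le_castSucc _ _ h, Fin.castPred_castSucc] at hk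
    subst hl hk
    exact Adj.homotopic ⟨_, .inr (.startStart ρ k' k (by simpa using h) ..)⟩

/-- The two adjacencies of two consecutive `finish` steps at once. -/
theorem homotopic_finishFinish {n : ℕ} {w : X.cell (n + 2)} (ρ : CubePath X (n + 2) w)
    (k k' : Fin (n + 1)) (l l' : Fin (n + 2)) (hk : k' = k.predAbove l) (hl : l' = l.succAbove k)
    (x y : X.cell (n + 1)) (z : X.cell n) (h₁ h₂ h₃ h₄) :
    Homotopic ((ρ.finish l x h₁).finish k z h₂) ((ρ.finish l' y h₃).finish k' z h₄) := by
  rcases lt_or_ge k.castSucc l with h | h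
  · obtain ⟨j, rfl⟩ := Fin.exists_succ_eq.2 (Fin.ne_zero_of_lt h)
    rw [Fin.succAbove_of_castSucc_lt _ _ h] at hl
    rw [Fin.predAbove_of_castSucc_lt _ _ h, Fin.pred_succ] at hk
    subst hl hk
    exact Adj.homotopic ⟨_, .inl (.finishFinish ρ k k' (Fin.castSucc_lt_succ_iff.1 h) ..)⟩
  · have hl' : l ≠ Fin.last _ := ne_of_lt (lt_of_le_of_lt h (Fin.castSucc_lt_last k))
    obtain ⟨j, rfl⟩ := Fin.exists_castSucc_eq.2 hl'
    rw [Fin.succAbove_of_le_castSucc _ _ h] at hl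
    rw [Fin.predAbove_of_le_castSucc _ _ h, Fin.castPred_castSucc] at hk
    subst hl hk
    exact Adj.homotopic ⟨_, .inr (.finishFinish ρ k' k (by simpa using h) ..)⟩

/-- The two adjacencies that exchange a `start` and a `finish` step at once. -/
theorem homotopic_startFinish {n : ℕ} {w : X.cell (n + 1)} (ρ : CubePath X (n + 1) w)
    (k k' : Fin (n + 1)) (l l' : Fin (n + 2)) (hk : k' = k.predAbove l) (hl : l' = l.succAbove k)
    (x : X.cell n) (y : X.cell (n + 2)) (z : X.cell (n + 1)) (h₁ h₂ h₃ h₄) :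
    Homotopic ((ρ.start l y h₁).finish l' z h₂) ((ρ.finish k x h₃).start k' z h₄) := by
  rcases lt_or_ge k.castSucc l with h | h
  · obtain ⟨j, rfl⟩ := Fin.exists_succ_eq.2 (Fin.ne_zero_of_lt h)
    rw [Fin.succAbove_of_castSucc_lt _ _ h] at hl
    rw [Fin.predAbove_of_castSucc_lt _ _ h, Fin.pred_succ] at hk
    subst hl hk
    exact Adj.homotopic ⟨_, .inr (.startFinish' ρ k k' (Fin.castSucc_lt_succ_iff.1 h) ..)⟩
  · have hl' : l ≠ Fin.last _ := ne_of_lt (lt_of_le_of_lt h (Fin.castSucc_lt_last k))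
    obtain ⟨j, rfl⟩ := Fin.exists_castSucc_eq.2 hl'
    rw [Fin.succAbove_of_le_castSucc _ _ h] at hl
    rw [Fin.predAbove_of_le_castSucc _ _ h, Fin.castPred_castSucc] at hk
    subst hl hk
    exact Adj.homotopic ⟨_, .inr (.startFinish ρ k' k (by simpa using h) ..)⟩

/-- The cube path obtained from a path to `x` by erasing the start of the running event in direction
`k`; it is, up to homotopy, the only path to `δ k false x` whose extension by `x` is homotopic to the
given one, see `start_lower` and `Homotopic.of_start`. -/
noncomputable def lower : ∀ {n : ℕ} {x : X.cell (n + 1)}, CubePath X (n + 1) x →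
    ∀ k : Fin (n + 1), CubePath X n (X.δ k false x)
  | 0, _, start ρ l y h, k => (show X.δ k false y = _ by rw [Fin.ext (by omega : (k : ℕ) = l), h]) ▸ ρ
  | n + 1, _, start ρ l y h, k =>
    if hk : k = l then (show X.δ k false y = _ by rw [hk, h]) ▸ ρ
    else
      let k' := (Fin.exists_succAbove_eq hk).choose
      have hk' : l.succAbove k' = k := (Fin.exists_succAbove_eq hk).choose_spec
      start (lower ρ k') (k'.predAbove l) (X.δ k false y) (by rw [← hk', ← δ_δ', h])
  | n, _, finish ρ l x h, k =>
    finish (lower ρ (l.succAbove k)) (k.predAbove l) (X.δ k false x) (by rw [← δ_δ', h])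

theorem lower_start_same {n : ℕ} {x : X.cell n} (ρ : CubePath X n x) (l : Fin (n + 1))
    (y : X.cell (n + 1)) (h : X.δ l false y = x) : lower (ρ.start l y h) l = h.symm ▸ ρ := by
  subst h
  cases n <;> simp [lower]

theorem lower_start_succAbove {n : ℕ} {x : X.cell (n + 1)} (ρ : CubePath X (n + 1) x)
    (l : Fin (n + 2)) (k : Fin (n + 1)) (y : X.cell (n + 2)) (h : X.δ l false y = x) :
    lower (ρ.start l y h) (l.succAbove k) = start (lower ρ k) (k.predAbove l)
      (X.δ (l.succAbove k) false y) (by rw [← δ_δ', h]) := by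
  have hk := Fin.succAbove_ne l k
  have := (Fin.exists_succAbove_eq hk).choose_spec
  rw [Fin.succAbove_right_inj] at this
  simp only [lower, hk, dite_false, start.injEq]
  rw [this]
  exact ⟨rfl, HEq.rfl, rfl⟩

theorem lower_finish {n : ℕ} {y : X.cell (n + 2)} (ρ : CubePath X (n + 2) y) (l : Fin (n + 2))
    (x : X.cell (n + 1)) (h : X.δ l true y = x) (k : Fin (n + 1)) :
    lower (ρ.finish l x h) k = finish (lower ρ (l.succAbove k)) (k.predAbove l)
      (X.δ k false x) (by rw [← δ_δ', h]) := by
  simp [lower]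

/-- Erasing and then reintroducing an event does not change the homotopy class. -/
theorem start_lower : ∀ {n : ℕ} {x : X.cell (n + 1)} (ρ : CubePath X (n + 1) x) (k : Fin (n + 1)),
    Homotopic ((lower ρ k).start k x rfl) ρ
  | 0, _, start ρ l _ h, k => by
    subst h
    obtain rfl : k = l := Fin.ext (by omega)
    rw [lower_start_same]
    exact .refl
  | n + 1, _, start ρ l y h, k => by
    rcases eq_or_ne k l with rfl | hk
    · subst h
      rw [lower_start_same]
      exact .refl
    · obtain ⟨k, rfl⟩ := Fin.exists_succAbove_eq hk
      rw [lower_start_succAbove]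
      refine .trans ?_ ((start_lower ρ k).start l y h)
      exact (homotopic_startStart (lower ρ k) k _ l _ rfl rfl ..).symm
  | n, _, finish ρ l x h, k => by
    rw [lower_finish]
    refine .trans ?_ ((start_lower ρ (l.succAbove k)).finish l x h)
    refine (homotopic_startFinish (lower ρ (l.succAbove k)) _ _ _ _ ?_ ?_ ..).symm
    · exact (Fin.predAbove_predAbove_succAbove _ _).symm
    · exact (Fin.succAbove_succAbove_predAbove _ _).symm
termination_by _ _ ρ => ρ.length
decreasing_by all_goals simp [length]

theorem lower_start_same' {n : ℕ} {x : X.cell n} (ρ : CubePath X n x) (l m : Fin (n + 1))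
    (y : X.cell (n + 1)) (h : X.δ l false y = x) (hm : m = l) :
    lower (ρ.start l y h) m = (show x = X.δ m false y by rw [hm, h]) ▸ ρ := by
  subst hm
  exact lower_start_same ..

theorem lower_start_ne {n : ℕ} {x : X.cell (n + 1)} (ρ : CubePath X (n + 1) x)
    (l m : Fin (n + 2)) (k : Fin (n + 1)) (y : X.cell (n + 2)) (h : X.δ l false y = x)
    (hm : m = l.succAbove k) :
    lower (ρ.start l y h) m = start (lower ρ k) (k.predAbove l)
      (X.δ m false y) (by rw [hm, ← δ_δ', h]) := by
  subst hm
  exact lower_start_succAbove ..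

theorem lower_finish' {n : ℕ} {y : X.cell (n + 2)} (ρ : CubePath X (n + 2) y) (l m : Fin (n + 2))
    (x : X.cell (n + 1)) (h : X.δ l true y = x) (k : Fin (n + 1)) (hm : m = l.succAbove k) :
    lower (ρ.finish l x h) k = finish (lower ρ m) (k.predAbove l)
      (X.δ k false x) (by rw [hm, ← δ_δ', h]) := by
  subst hm
  exact lower_finish ..

theorem start_cast {n : ℕ} {x x' : X.cell n} (ρ : CubePath X n x) (hx : x = x') (k k' : Fin (n + 1))
    (hk : k = k') (y : X.cell (n + 1)) (h h') :
    (hx ▸ ρ : CubePath X n x').start k y h = ρ.start k' y h' := by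
  subst hx hk; rfl

theorem finish_cast {n : ℕ} {y y' : X.cell (n + 1)} (ρ : CubePath X (n + 1) y) (hy : y = y')
    (k k' : Fin (n + 1)) (hk : k = k') (x : X.cell n) (h h') :
    (hy ▸ ρ : CubePath X (n + 1) y').finish k x h = ρ.finish k' x h' := by
  subst hy hk; rfl

theorem cast_start {n : ℕ} {x : X.cell n} {y y' : X.cell (n + 1)} (ρ : CubePath X n x)
    (k : Fin (n + 1)) (hy : y = y') (h) :
    (hy ▸ ρ.start k y h : CubePath X (n + 1) y') = ρ.start k y' (hy ▸ h) := by
  subst hy; rfl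

theorem cast_finish {n : ℕ} {y : X.cell (n + 1)} {x x' : X.cell n} (ρ : CubePath X (n + 1) y)
    (k : Fin (n + 1)) (hx : x = x') (h) :
    (hx ▸ ρ.finish k x h : CubePath X n x') = ρ.finish k x' (hx ▸ h) := by
  subst hx; rfl

theorem predAbove_coherence {n : ℕ} (l : Fin (n + 3)) (k : Fin (n + 2)) (m : Fin (n + 1)) :
    m.predAbove (k.predAbove l) = (m.predAbove k).predAbove ((k.succAbove m).predAbove l) := by
  ext
  simp only [Fin.succAbove, Fin.predAbove, Fin.lt_def, Fin.val_castSucc, apply_dite Fin.val,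
    Fin.val_pred, Fin.coe_castPred, dite_eq_ite, apply_ite Fin.val, Fin.val_succ]
  split_ifs <;> lia

theorem succAbove_coherence {n : ℕ} (l : Fin (n + 3)) (k : Fin (n + 2)) (m : Fin (n + 1)) :
    ((k.predAbove l).succAbove m).predAbove (l.succAbove k) =
      ((k.succAbove m).predAbove l).succAbove (m.predAbove k) := by
  ext
  simp only [Fin.succAbove, Fin.predAbove, Fin.lt_def, Fin.val_castSucc, apply_dite Fin.val,
    Fin.val_pred, Fin.coe_castPred, dite_eq_ite, apply_ite Fin.val, Fin.val_succ]
  split_ifs <;> lia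

theorem lower_startStart {n : ℕ} {w : X.cell n} (ρ : CubePath X n w) (k k' : Fin (n + 1))
    (l l' : Fin (n + 2)) (hk : k' = k.predAbove l) (hl : l' = l.succAbove k)
    (x y : X.cell (n + 1)) (z : X.cell (n + 2)) (h₁ h₂ h₃ h₄) (m : Fin (n + 2)) :
    Homotopic (lower ((ρ.start k x h₁).start l z h₂) m)
      (lower ((ρ.start k' y h₃).start l' z h₄) m) := by
  have hlk : l = l'.succAbove k' := by
    rw [hl, hk, Fin.succAbove_succAbove_predAbove]
  have hkl : k = k'.predAbove l' := by
    rw [hl, hk, Fin.predAbove_predAbove_succAbove]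
  rcases eq_or_ne m l with hm | hm
  · rw [lower_start_same' _ _ _ _ _ hm, lower_start_ne _ _ _ k' _ _ (hm.trans hlk),
      lower_start_same' _ _ _ _ _ rfl, start_cast _ _ _ k hkl.symm, cast_start]
    exact .refl
  · obtain ⟨m, rfl⟩ := Fin.exists_succAbove_eq hm
    rcases eq_or_ne m k with rfl | hm
    · rw [lower_start_same' _ l' _ _ _ hl.symm, lower_start_ne _ _ _ m _ _ rfl,
        lower_start_same' _ _ _ _ _ rfl, start_cast _ _ _ k' hk.symm, cast_start]
      exact .refl
    · match n, w, ρ, k, k', l, l', hk, hl, x, y, z, h₁, h₂, h₃, h₄, hlk, hkl, m, hm with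
      | 0, _, _, k, _, _, _, _, _, _, _, _, _, _, _, _, _, _, m, hm =>
        exact absurd (Fin.ext (by omega)) hm
      | n + 1, w, ρ, k, k', l, l', hk, hl, x, y, z, h₁, h₂, h₃, h₄, hlk, hkl, m, hm =>
        obtain ⟨m, rfl⟩ := Fin.exists_succAbove_eq hm
        rw [lower_start_ne _ _ _ (k.succAbove m) _ _ rfl, lower_start_ne _ _ _ m _ _ rfl,
          lower_start_ne _ l' _ (k'.succAbove m) _ _
            (by rw [hl, hk, Fin.succAbove_succAbove_succAbove_predAbove]),
          lower_start_ne _ k' _ m _ _ rfl]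
        refine homotopic_startStart (lower ρ m) _ _ _ _ ?_ ?_ ..
        · rw [hk, predAbove_coherence]
        · rw [hl, hk, succAbove_coherence]

theorem lower_finishFinish {n : ℕ} {w : X.cell (n + 3)} (ρ : CubePath X (n + 3) w)
    (k k' : Fin (n + 2)) (l l' : Fin (n + 3)) (hk : k' = k.predAbove l) (hl : l' = l.succAbove k)
    (x y : X.cell (n + 2)) (z : X.cell (n + 1)) (h₁ h₂ h₃ h₄) (m : Fin (n + 1)) :
    Homotopic (lower ((ρ.finish l x h₁).finish k z h₂) m)
      (lower ((ρ.finish l' y h₃).finish k' z h₄) m) := by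
  rw [lower_finish' _ _ _ _ _ _ rfl, lower_finish' _ _ _ _ _ _ rfl, lower_finish' _ k' _ _ _ _ rfl,
    lower_finish' _ l' (l.succAbove (k.succAbove m)) _ _ _
      (by rw [hl, hk, Fin.succAbove_succAbove_succAbove_predAbove])]
  refine homotopic_finishFinish (lower ρ _) _ _ _ _ ?_ ?_ ..
  · rw [hk, predAbove_coherence]
  · rw [hl, hk, succAbove_coherence]

theorem lower_startFinish {n : ℕ} {w : X.cell (n + 1)} (ρ : CubePath X (n + 1) w)
    (k k' : Fin (n + 1)) (l l' : Fin (n + 2)) (hk : k' = k.predAbove l) (hl : l' = l.succAbove k)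
    (x : X.cell n) (y : X.cell (n + 2)) (z : X.cell (n + 1)) (h₁ h₂ h₃ h₄) (m : Fin (n + 1)) :
    Homotopic (lower ((ρ.start l y h₁).finish l' z h₂) m)
      (lower ((ρ.finish k x h₃).start k' z h₄) m) := by
  have hlk : l = l'.succAbove k' := by
    rw [hl, hk, Fin.succAbove_succAbove_predAbove]
  have hkl : k = k'.predAbove l' := by
    rw [hl, hk, Fin.predAbove_predAbove_succAbove]
  rcases eq_or_ne m k' with hm | hm
  · rw [lower_start_same' _ _ _ _ _ hm, lower_finish' _ _ _ _ _ _ rfl,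
      lower_start_same' _ _ _ _ _ (by rw [hm, hlk]), finish_cast _ _ _ k (by rw [hm, hkl]),
      cast_finish]
    exact .refl
  · match n, w, ρ, k, k', l, l', hk, hl, x, y, z, h₁, h₂, h₃, h₄, hlk, hkl, m, hm with
    | 0, _, _, _, k', _, _, _, _, _, _, _, _, _, _, _, _, _, m, hm =>
      exact absurd (Fin.ext (by omega)) hm
    | n + 1, w, ρ, k, k', l, l', hk, hl, x, y, z, h₁, h₂, h₃, h₄, hlk, hkl, m, hm =>
      obtain ⟨m, rfl⟩ := Fin.exists_succAbove_eq hm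
      rw [lower_finish' _ l' (l.succAbove (k.succAbove m)) _ _ _
          (by rw [hl, hk, Fin.succAbove_succAbove_succAbove_predAbove]),
        lower_start_ne _ l _ _ _ _ rfl, lower_start_ne _ k' _ m _ _ rfl,
        lower_finish' _ _ _ _ _ _ rfl]
      refine homotopic_startFinish (lower ρ _) _ _ _ _ ?_ ?_ ..
      · rw [hk, predAbove_coherence]
      · rw [hl, hk, succAbove_coherence]

theorem AdjOneWay.lower : ∀ {p n : ℕ} {x : X.cell (n + 1)} {ρ σ : CubePath X (n + 1) x},
    AdjOneWay p ρ σ → ∀ m : Fin (n + 1), Homotopic (ρ.lower m) (σ.lower m)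
  | _, _, _, _, _, .startStart ρ k l hkl .., m =>
    lower_startStart ρ _ _ _ _
      (by rw [Fin.predAbove_succ_of_le _ _ hkl]) (by rw [Fin.succAbove_succ_of_le _ _ hkl]) ..
  | _, _, _, _, _, .finishFinish ρ k l hkl .., m =>
    lower_finishFinish ρ _ _ _ _
      (by rw [Fin.predAbove_succ_of_le _ _ hkl]) (by rw [Fin.succAbove_succ_of_le _ _ hkl]) ..
  | _, _, _, _, _, .startFinish ρ k l hkl .., m =>
    (lower_startFinish ρ _ _ _ _ (by rw [Fin.predAbove_castSucc_of_le _ _ hkl])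
      (by rw [Fin.succAbove_castSucc_of_le _ _ hkl]) ..).symm
  | _, _, _, _, _, .startFinish' ρ k l hkl .., m =>
    (lower_startFinish ρ _ _ _ _ (by rw [Fin.predAbove_succ_of_le _ _ hkl])
      (by rw [Fin.succAbove_succ_of_le _ _ hkl]) ..).symm
  | _, 0, _, _, _, .congrStart (ρ := ρ) (σ := σ) h k x hx, m => by
    obtain rfl : m = k := Fin.ext (by omega)
    subst hx
    rw [lower_start_same, lower_start_same]
    exact Adj.homotopic ⟨_, .inl h⟩
  | _, n + 1, _, _, _, .congrStart (ρ := ρ) (σ := σ) h k x hx, m => by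
    rcases eq_or_ne m k with rfl | hm
    · subst hx
      rw [lower_start_same, lower_start_same]
      exact Adj.homotopic ⟨_, .inl h⟩
    · obtain ⟨m, rfl⟩ := Fin.exists_succAbove_eq hm
      rw [lower_start_succAbove, lower_start_succAbove]
      exact (AdjOneWay.lower h m).start ..
  | _, _, _, _, _, .congrFinish (ρ := ρ) h k x hx, m => by
    rw [lower_finish, lower_finish]
    exact (AdjOneWay.lower h _).finish ..
termination_by _ _ _ ρ => ρ.length
decreasing_by all_goals simp [length]

theorem Homotopic.lower {n : ℕ} {x : X.cell (n + 1)} {ρ σ : CubePath X (n + 1) x}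
    (h : Homotopic ρ σ) (k : Fin (n + 1)) : Homotopic (ρ.lower k) (σ.lower k) :=
  h.lift (fun τ => τ.lower k) fun _ _ _ h => h.lower k

theorem Homotopic.of_start {n : ℕ} {x : X.cell n} {ρ σ : CubePath X n x} {k : Fin (n + 1)}
    {y : X.cell (n + 1)} {h : X.δ k false y = x}
    (hρ : Homotopic (ρ.start k y h) (σ.start k y h)) : Homotopic ρ σ := by
  subst h
  have := hρ.lower k
  rwa [lower_start_same, lower_start_same] at this

/-- The erasing operation in terms of homotopy alone. -/
theorem homotopic_lower_iff {n : ℕ} {x : X.cell (n + 1)} (ρ : CubePath X (n + 1) x)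
    (k : Fin (n + 1)) (σ : CubePath X n (X.δ k false x)) :
    Homotopic σ (ρ.lower k) ↔ Homotopic (σ.start k x rfl) ρ :=
  ⟨fun h => (h.start k x rfl).trans (start_lower ρ k),
    fun h => .of_start (h.trans (start_lower ρ k).symm)⟩

end CubePath

/-! ### Unfoldings -/

/-- The cubes of the unfolding: homotopy classes of pointed cube paths ending in an `n`-cube. -/
def UnfoldCell (X : HDA.{u}) (n : ℕ) : Type u :=
  Σ x : X.cell n, Quotient (CubePath.homotopySetoid X n x)

namespace UnfoldCell

variable {X : HDA.{u}}

/-- The homotopy class of a pointed cube path. -/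
def mk {n : ℕ} {x : X.cell n} (ρ : CubePath X n x) : UnfoldCell X n :=
  ⟨x, Quotient.mk (CubePath.homotopySetoid X n x) ρ⟩

theorem mk_eq {n : ℕ} {x : X.cell n} {ρ σ : CubePath X n x} (h : ρ.Homotopic σ) :
    mk ρ = mk σ := by
  unfold mk
  rw [Quotient.sound (s := CubePath.homotopySetoid X n x) h]

theorem ind {n : ℕ} {p : UnfoldCell X n → Prop}
    (h : ∀ (x : X.cell n) (ρ : CubePath X n x), p (mk ρ)) (a : UnfoldCell X n) : p a := by
  obtain ⟨x, q⟩ := a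
  exact Quotient.inductionOn (s := CubePath.homotopySetoid X n x) q (h x)

/-- Face maps of the unfolding. The lower face of the class of `ρ` is the class of all `σ` whose
extension by the last cube of `ρ` is homotopic to `ρ` (see `CubePath.homotopic_lower_iff`); the upper
face is the class of the extension of `ρ` by the upper face of its last cube. -/
noncomputable def face {n : ℕ} (k : Fin (n + 1)) : Bool → UnfoldCell X (n + 1) → UnfoldCell X n
  | false, ⟨x, q⟩ => ⟨X.δ k false x, Quotient.map (sa := CubePath.homotopySetoid X _ _)
      (sb := CubePath.homotopySetoid X _ _) (fun ρ => ρ.lower k) (fun _ _ h => h.lower k) q⟩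
  | true, ⟨x, q⟩ => ⟨X.δ k true x, Quotient.map (sa := CubePath.homotopySetoid X _ _)
      (sb := CubePath.homotopySetoid X _ _) (fun ρ => ρ.finish k _ rfl)
      (fun _ _ h => h.finish k _ rfl) q⟩

theorem face_true {n : ℕ} {x : X.cell (n + 1)} {y : X.cell n} (ρ : CubePath X (n + 1) x)
    (k : Fin (n + 1)) (h : X.δ k true x = y) : face k true (mk ρ) = mk (ρ.finish k y h) := by
  subst h; rfl

theorem face_false {n : ℕ} {x : X.cell n} {y : X.cell (n + 1)} (ρ : CubePath X n x)
    (σ : CubePath X (n + 1) y) (k : Fin (n + 1)) (h : X.δ k false y = x)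
    (hσ : (ρ.start k y h).Homotopic σ) : face k false (mk σ) = mk ρ := by
  subst h
  exact (mk_eq ((CubePath.homotopic_lower_iff σ k ρ).2 hσ)).symm

theorem face_false_mk {n : ℕ} {y : X.cell (n + 1)} (σ : CubePath X (n + 1) y) (k : Fin (n + 1)) :
    face k false (mk σ) = mk (σ.lower k) := rfl

theorem face_face {n : ℕ} (l : Fin (n + 2)) (k : Fin (n + 1)) (ν μ : Bool)
    (a : UnfoldCell X (n + 2)) :
    face k ν (face l μ a) = face (k.predAbove l) μ (face (l.succAbove k) ν a) := by
  induction a using ind with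
  | h x ρ =>
    have hl := Fin.succAbove_succAbove_predAbove l k
    have hk := Fin.predAbove_predAbove_succAbove l k
    match ν, μ with
    | true, true =>
      rw [face_true _ _ rfl, face_true _ _ rfl, face_true _ _ rfl, face_true _ _ (δ_δ' ..).symm]
      exact mk_eq (CubePath.homotopic_finishFinish ρ _ _ _ _ rfl rfl ..)
    | false, false =>
      rw [face_false_mk, face_false_mk, face_false_mk]
      refine (face_false _ _ _ (δ_δ' ..).symm ?_).symm
      refine CubePath.Homotopic.of_start (k := l.succAbove k) (y := x) (h := rfl) ?_
      refine .trans ?_ (CubePath.start_lower ρ (l.succAbove k)).symm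
      refine .trans ?_ (CubePath.start_lower ρ l)
      refine .trans ?_ ((CubePath.start_lower (ρ.lower l) k).start l x rfl)
      exact (CubePath.homotopic_startStart _ _ _ _ _ rfl rfl ..).symm
    | true, false =>
      rw [face_false_mk, face_true _ _ rfl, face_true _ _ rfl]
      refine (face_false _ _ _ (δ_δ' ..).symm ?_).symm
      refine .trans ?_ ((CubePath.start_lower ρ l).finish (l.succAbove k) _ rfl)
      exact (CubePath.homotopic_startFinish _ _ _ _ _ rfl rfl ..).symm
    | false, true =>
      rw [face_false_mk, face_true _ _ rfl, face_true _ _ (δ_δ' ..).symm]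
      refine face_false _ _ _ rfl ?_
      refine .trans ?_ ((CubePath.start_lower ρ (l.succAbove k)).finish l _ rfl)
      exact (CubePath.homotopic_startFinish _ _ _ _ _ hk.symm hl.symm ..).symm

end UnfoldCell

/-- The unfolding of an HDA. -/
noncomputable def unfold (X : HDA.{u}) : HDA.{u} where
  cell := UnfoldCell X
  δ := UnfoldCell.face
  δ_δ k l ν μ a h := by
    rw [UnfoldCell.face_face l.succ k, Fin.predAbove_succ_of_le _ _ h,
      Fin.succAbove_succ_of_le _ _ h]
  pt := UnfoldCell.mk .nil

/-- The projection of the unfolding, sending a homotopy class of cube paths to their last cube. -/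
noncomputable def proj (X : HDA.{u}) : unfold X ⟶ X where
  map a := a.1
  map_δ k ν a := by cases ν <;> rfl
  map_pt := rfl

/-- The morphism of unfoldings induced by a morphism of HDA, applying it to all cubes of a path. -/
noncomputable def unfoldMap {X Y : HDA.{u}} (f : X ⟶ Y) : unfold X ⟶ unfold Y where
  map a := ⟨f.map a.1, Quotient.map (sa := CubePath.homotopySetoid X _ _)
    (sb := CubePath.homotopySetoid Y _ _) (CubePath.map f) (fun _ _ h => h.map f) a.2⟩
  map_δ {n} k ν a := by
    induction a using UnfoldCell.ind with
    | h x ρ =>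
      cases ν
      · refine (UnfoldCell.face_false (CubePath.map f (ρ.lower k)) (CubePath.map f ρ) k
          (Hom.map_δ f k false x).symm ?_).symm
        exact (CubePath.start_lower ρ k).map f
      · exact (UnfoldCell.face_true (CubePath.map f ρ) k (Hom.map_δ f k true x).symm).symm
  map_pt := by
    have : ∀ (y : Y.cell 0) (h : Y.pt = y),
        UnfoldCell.mk (h ▸ CubePath.nil : CubePath Y 0 y) = UnfoldCell.mk .nil := by
      rintro _ rfl; rfl
    exact this _ (Hom.map_pt f).symm

/-! ### Higher-dimensional paths and open maps -/

/-- A pointed cube path together with its end. -/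
structure Path (X : HDA.{u}) : Type u where
  dim : ℕ
  last : X.cell dim
  path : CubePath X dim last

namespace Path

variable {X Y : HDA.{u}}

/-- The cube path consisting of the point only. -/
def nil (X : HDA.{u}) : Path X := ⟨0, X.pt, .nil⟩

/-- The image of a path under a morphism. -/
def map (f : X ⟶ Y) (ρ : Path X) : Path Y := ⟨ρ.dim, f.map ρ.last, ρ.path.map f⟩

/-- Extension of a path by one step. -/
inductive Step : Path X → Path X → Prop
  | start {n : ℕ} {x : X.cell n} (ρ : CubePath X n x) (k : Fin (n + 1)) (y : X.cell (n + 1)) (h) :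
      Step ⟨n, x, ρ⟩ ⟨n + 1, y, ρ.start k y h⟩
  | finish {n : ℕ} {y : X.cell (n + 1)} (ρ : CubePath X (n + 1) y) (k : Fin (n + 1))
      (x : X.cell n) (h) : Step ⟨n + 1, y, ρ⟩ ⟨n, x, ρ.finish k x h⟩

/-- The prefix relation. -/
def IsPrefix (ρ σ : Path X) : Prop := Relation.ReflTransGen Step ρ σ

/-- Adjacency at position `p`, for paths bundled with their ends. -/
inductive AdjAt (p : ℕ) : Path X → Path X → Prop
  | mk {n : ℕ} {x : X.cell n} {ρ σ : CubePath X n x} (h : ρ.AdjAt p σ) :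
      AdjAt p ⟨n, x, ρ⟩ ⟨n, x, σ⟩

end Path

/-- `P` is the path object on the cube path `τ`: it is freely generated by `τ`, so that morphisms from
`P` to an HDA `Y` are the same as pointed cube paths in `Y` of the same shape as `τ`. -/
def IsPathObject (P : HDA.{u}) (τ : Path P) : Prop :=
  ∀ (Y : HDA.{u}) (σ : Path Y), σ.path.shape = τ.path.shape → ∃! f : P ⟶ Y, τ.map f = σ

/-- Morphisms of higher-dimensional paths: they are generated by pointed cube path extensions and
isomorphisms of path objects. -/
inductive IsPathMorphism : ∀ {P Q : HDA.{u}}, (P ⟶ Q) → Prop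
  | extension {P Q : HDA.{u}} (τ : Path P) (τ' : Path Q) (hP : IsPathObject P τ)
      (hQ : IsPathObject Q τ') (f : P ⟶ Q) (hf : (τ.map f).IsPrefix τ') : IsPathMorphism f
  | iso {P Q : HDA.{u}} (τ : Path P) (τ' : Path Q) (hP : IsPathObject P τ)
      (hQ : IsPathObject Q τ') (f : P ⟶ Q) (hf : IsIso f) : IsPathMorphism f
  | comp {P Q R : HDA.{u}} (f : P ⟶ Q) (g : Q ⟶ R) (hf : IsPathMorphism f)
      (hg : IsPathMorphism g) : IsPathMorphism (f ≫ g)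

/-- The subcategory of higher-dimensional paths. -/
def HDP : MorphismProperty HDA.{u} := fun _ _ f => IsPathMorphism f

end HDA

/-- The category of HDA up to homotopy: its objects are HDA, and its morphisms are the pointed
precubical morphisms of the unfoldings. -/
abbrev HDAh : Type (u + 1) := InducedCategory HDA.{u} HDA.unfold

namespace HDAh

open HDA

/-- The subcategory of higher-dimensional paths in `HDAh`, the image of `HDP`. -/
def HDPh : MorphismProperty HDAh.{u} := fun P Q f =>
  ∃ g : (show HDA.{u} from P) ⟶ (show HDA.{u} from Q), HDP g ∧ f.hom = unfoldMap g

/-- A morphism in `HDAh` is open if it has the right lifting property with respect to `HDPh`. -/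
def IsOpen {X Y : HDAh.{u}} (f : X ⟶ Y) : Prop := HDPh.rlp f

end HDAh

/-! ### Labels -/

/-- The higher-dimensional torus on a set of labels: its `n`-cubes are the sorted sequences of `n` labels,
and the faces in direction `k` omit the `k`-th label. -/
def torus (S : Type u) [LinearOrder S] : HDA.{u} where
  cell n := {w : Fin n → S // Monotone w}
  δ k _ w := ⟨fun i => w.1 (k.succAbove i), w.2.comp (Fin.strictMono_succAbove k).monotone⟩
  δ_δ k l _ _ w h := by
    refine Subtype.ext (funext fun i => congrArg w.1 ?_)
    have := Fin.succAbove_succAbove_succAbove_predAbove l.succ k i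
    rw [Fin.predAbove_succ_of_le _ _ h, Fin.succAbove_succ_of_le _ _ h] at this
    exact this.symm
  pt := ⟨Fin.elim0, fun i => i.elim0⟩

/-- Labelled higher-dimensional automata over the label set `S`. -/
structure LHDA (S : Type u) [LinearOrder S] : Type (u + 1) extends HDA.{u} where
  lab : toHDA ⟶ torus S

namespace LHDA

open HDA

variable {S : Type u} [LinearOrder S]

/-- An HDA with labels as an object of `HDAh`. -/
abbrev toHDAh (X : LHDA S) : HDAh.{u} := X.toHDA

/-- A morphism of `HDAh` preserves labels if it commutes with the labelings of the unfoldings, which have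
values in the unfolding of the torus. -/
def PreservesLabels {X Y : LHDA S} (f : X.toHDAh ⟶ Y.toHDAh) : Prop :=
  f.hom ≫ unfoldMap Y.lab = unfoldMap X.lab

/-- Homotopy bisimilarity: there is a span of label-preserving open maps in `HDAh`. -/
def HomotopyBisimilar (X Y : LHDA S) : Prop :=
  ∃ (Z : LHDA S) (f : Z.toHDAh ⟶ X.toHDAh) (g : Z.toHDAh ⟶ Y.toHDAh),
    PreservesLabels f ∧ PreservesLabels g ∧ HDAh.IsOpen f ∧ HDAh.IsOpen g

/-! ### Split, ST- and history-preserving bisimilarity -/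

/-- For each event running at the end of a cube path (that is, for each direction of its last cube),
the position of the step at which this event was started. -/
def started {X : HDA.{u}} : ∀ {n : ℕ} {x : X.cell n}, CubePath X n x → Fin n → ℕ
  | _, _, .nil => Fin.elim0
  | _, _, .start ρ k _ _ => k.insertNth (α := fun _ => ℕ) ρ.length (started ρ)
  | _, _, .finish ρ k _ _ => fun i => started ρ (k.succAbove i)

/-- The beginning or the end of an action. -/
inductive SplitAction (S : Type u) : Type u
  | start (a : S)
  | finish (a : S)

/-- The beginning of an action, or the end of an action that was started at position `j`. -/
inductive STAction (S : Type u) : Type u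
  | start (a : S)
  | finish (a : S) (j : ℕ)

/-- The split trace of a cube path. -/
def splitTrace (X : LHDA S) : ∀ {n : ℕ} {x : X.cell n}, CubePath X.toHDA n x → List (SplitAction S)
  | _, _, .nil => []
  | _, _, .start ρ k y _ => splitTrace X ρ ++ [.start ((X.lab.map y).1 k)]
  | _, _, .finish (y := y) ρ k _ _ => splitTrace X ρ ++ [.finish ((X.lab.map y).1 k)]

/-- The ST-trace of a cube path: the end of an action also records where that action was started. -/
def stTrace (X : LHDA S) : ∀ {n : ℕ} {x : X.cell n}, CubePath X.toHDA n x → List (STAction S)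
  | _, _, .nil => []
  | _, _, .start ρ k y _ => stTrace X ρ ++ [.start ((X.lab.map y).1 k)]
  | _, _, .finish (y := y) ρ k _ _ => stTrace X ρ ++ [.finish ((X.lab.map y).1 k) (started ρ k)]

/-- A relation between pointed cube paths that relates the trivial paths and has the forth and back
properties for extensions of paths. -/
structure IsPathBisimulation (X Y : LHDA S) (R : Path X.toHDA → Path Y.toHDA → Prop) : Prop where
  init : R (Path.nil _) (Path.nil _)
  forth : ∀ ρ σ ρ', R ρ σ → ρ.Step ρ' → ∃ σ', σ.Step σ' ∧ R ρ' σ'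
  back : ∀ ρ σ σ', R ρ σ → σ.Step σ' → ∃ ρ', ρ.Step ρ' ∧ R ρ' σ'

/-- Split bisimilarity: a bisimulation between paths with the same beginnings and ends of actions. -/
def SplitBisimilar (X Y : LHDA S) : Prop :=
  ∃ R, IsPathBisimulation X Y R ∧ ∀ ρ σ, R ρ σ → X.splitTrace ρ.path = Y.splitTrace σ.path

/-- ST-bisimilarity: a bisimulation between paths with the same ST-traces. -/
def STBisimilar (X Y : LHDA S) : Prop :=
  ∃ R, IsPathBisimulation X Y R ∧ ∀ ρ σ, R ρ σ → X.stTrace ρ.path = Y.stTrace σ.path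

/-- History-preserving bisimilarity: an ST-bisimulation in which, moreover, every adjacency on one side
is matched by an adjacency at the same position on the other side. -/
def HistoryPreservingBisimilar (X Y : LHDA S) : Prop :=
  ∃ R, IsPathBisimulation X Y R ∧ (∀ ρ σ, R ρ σ → X.stTrace ρ.path = Y.stTrace σ.path) ∧
    (∀ p ρ σ ρ', R ρ σ → Path.AdjAt p ρ ρ' → ∃ σ', Path.AdjAt p σ σ' ∧ R ρ' σ') ∧
    (∀ p ρ σ σ', R ρ σ → Path.AdjAt p σ σ' → ∃ ρ', Path.AdjAt p ρ ρ' ∧ R ρ' σ')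

end LHDA

/-! ### Two-dimensional labelled HDA from finite data -/

/-- Data for a finite two-dimensional labelled HDA. An edge is given by its source, its target and its
label. A square with events `1` and `2` is given as `(p, q, p', q')`, where `p` and `q` are the edges
at its lower corner in which event `1`, respectively `2`, is running, and `p'` and `q'` are the edges
opposite to `p` and `q`. -/
structure SquareData (S : Type) [LinearOrder S] where
  nV : ℕ
  nE : ℕ
  nQ : ℕ
  init : Fin nV
  edge : Fin nE → Fin nV × Fin nV × S
  square : Fin nQ → Fin nE × Fin nE × Fin nE × Fin nE
  corner₀₀ : ∀ s, (edge (square s).1).1 = (edge (square s).2.1).1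
  corner₁₀ : ∀ s, (edge (square s).1).2.1 = (edge (square s).2.2.2).1
  corner₀₁ : ∀ s, (edge (square s).2.1).2.1 = (edge (square s).2.2.1).1
  corner₁₁ : ∀ s, (edge (square s).2.2.1).2.1 = (edge (square s).2.2.2).2.1
  label₁ : ∀ s, (edge (square s).1).2.2 = (edge (square s).2.2.1).2.2
  label₂ : ∀ s, (edge (square s).2.1).2.2 = (edge (square s).2.2.2).2.2
  sorted : ∀ s, (edge (square s).1).2.2 ≤ (edge (square s).2.1).2.2

namespace SquareData

variable {S : Type} [LinearOrder S] (D : SquareData S)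

/-- The cubes. -/
def Cell : ℕ → Type
  | 0 => Fin D.nV
  | 1 => Fin D.nE
  | 2 => Fin D.nQ
  | _ + 3 => Empty

/-- The face maps. -/
def face : ∀ {n : ℕ}, Fin (n + 1) → Bool → D.Cell (n + 1) → D.Cell n
  | 0, _, false, e => (D.edge e).1
  | 0, _, true, e => (D.edge e).2.1
  | 1, 0, false, s => (D.square s).2.1
  | 1, 0, true, s => (D.square s).2.2.2
  | 1, 1, false, s => (D.square s).1
  | 1, 1, true, s => (D.square s).2.2.1
  | _ + 2, _, _, s => s.elim

/-- The label sequence of a cube. -/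
def label : ∀ {n : ℕ}, D.Cell n → Fin n → S
  | 0, _ => Fin.elim0
  | 1, e => ![(D.edge e).2.2]
  | 2, s => ![(D.edge (D.square s).1).2.2, (D.edge (D.square s).2.1).2.2]
  | _ + 3, s => s.elim

/-- The underlying HDA. -/
def toHDA : HDA.{0} where
  cell := D.Cell
  δ := D.face
  δ_δ {n} k l ν μ s h := by
    match n with
    | 0 =>
      obtain rfl : k = 0 := Fin.ext (by omega)
      obtain rfl : l = 0 := Fin.ext (by omega)
      cases ν <;> cases μ
      · exact D.corner₀₀ s
      · exact (D.corner₀₁ s).symm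
      · exact D.corner₁₀ s
      · exact D.corner₁₁ s
    | n + 1 => exact s.elim
  pt := D.init

/-- The labelled HDA. -/
def toLHDA : LHDA S where
  toHDA := D.toHDA
  lab :=
    { map := fun {n} s => ⟨D.label s, by
        match n, s with
        | 0, _ => exact fun i => i.elim0
        | 1, _ => exact fun i j _ => by rw [Fin.ext (by omega : (i : ℕ) = j)]
        | 2, s =>
          intro i j h
          fin_cases i <;> fin_cases j
          · exact le_rfl
          · exact D.sorted s
          · exact absurd h (by decide)
          · exact le_rfl
        | n + 3, s => exact s.elim⟩
      map_δ := fun {n} k ν s => by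
        refine Subtype.ext (funext fun i => ?_)
        match n, k, ν, s with
        | 0, _, _, _ => exact i.elim0
        | 1, 0, false, s => obtain rfl : i = 0 := Fin.ext (by omega); rfl
        | 1, 0, true, s => obtain rfl : i = 0 := Fin.ext (by omega); exact (D.label₂ s).symm
        | 1, 1, false, s => obtain rfl : i = 0 := Fin.ext (by omega); rfl
        | 1, 1, true, s => obtain rfl : i = 0 := Fin.ext (by omega); exact (D.label₁ s).symm
        | n + 2, _, _, s => exact s.elim
      map_pt := Subtype.ext (funext fun i => i.elim0) }

end SquareData

/-! ### The examples -/

namespace Example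

/-- The alphabet `{a, b, c, d, e}`, in alphabetical order. -/
abbrev Letter : Type := Fin 5

abbrev a : Letter := 0
abbrev b : Letter := 1
abbrev c : Letter := 2
abbrev d : Letter := 3
abbrev e : Letter := 4

/-- Two concurrent events `a` and `b`, together with a branch in which `b` can be executed only after
`a`. Vertices are `x₀, …, x₄`, edges are `y₁, …, y₅` in this order, and the square is `z`. -/
def X₁ : LHDA Letter := SquareData.toLHDA
  { nV := 5, nE := 5, nQ := 1, init := 0
    edge := ![(0, 1, a), (0, 2, b), (1, 3, b), (1, 4, b), (2, 4, a)]
    square := ![(0, 1, 4, 3)]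
    corner₀₀ := by decide
    corner₁₀ := by decide
    corner₀₁ := by decide
    corner₁₁ := by decide
    label₁ := by decide
    label₂ := by decide
    sorted := by decide }

/-- Two concurrent events `a` and `b`. -/
def X₁' : LHDA Letter := SquareData.toLHDA
  { nV := 4, nE := 4, nQ := 1, init := 0
    edge := ![(0, 1, a), (0, 2, b), (1, 3, b), (2, 3, a)]
    square := ![(0, 1, 3, 2)]
    corner₀₀ := by decide
    corner₁₀ := by decide
    corner₀₁ := by decide
    corner₁₁ := by decide
    label₁ := by decide
    label₂ := by decide
    sorted := by decide }

/-- Five squares at the initial state: two, labelled `bc` and `ab`, that share their lower `b`-edge; two,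
labelled `ac` and `ab`, that share their lower `a`-edge; and a separate one labelled `ab`. Edge number
`k - 1` is `y_k` and square number `k - 1` is `z_k`. -/
def X₂ : LHDA Letter := SquareData.toLHDA
  { nV := 14, nE := 18, nQ := 5, init := 0
    edge := ![(0, 1, c), (0, 2, b), (0, 3, a), (1, 4, b), (2, 4, c), (2, 5, a), (3, 5, b),
      (0, 6, c), (0, 7, a), (0, 8, b), (6, 9, a), (7, 9, c), (7, 10, b), (8, 10, a),
      (0, 11, a), (0, 12, b), (11, 13, b), (12, 13, a)]
    square := ![(1, 0, 3, 4), (2, 1, 5, 6), (8, 7, 10, 11), (8, 9, 13, 12), (14, 15, 17, 16)]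
    corner₀₀ := by decide
    corner₁₀ := by decide
    corner₀₁ := by decide
    corner₁₁ := by decide
    label₁ := by decide
    label₂ := by decide
    sorted := by decide }

/-- The first four squares of `X₂`. -/
def X₂' : LHDA Letter := SquareData.toLHDA
  { nV := 11, nE := 14, nQ := 4, init := 0
    edge := ![(0, 1, c), (0, 2, b), (0, 3, a), (1, 4, b), (2, 4, c), (2, 5, a), (3, 5, b),
      (0, 6, c), (0, 7, a), (0, 8, b), (6, 9, a), (7, 9, c), (7, 10, b), (8, 10, a)]
    square := ![(1, 0, 3, 4), (2, 1, 5, 6), (8, 7, 10, 11), (8, 9, 13, 12)]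
    corner₀₀ := by decide
    corner₁₀ := by decide
    corner₀₁ := by decide
    corner₁₁ := by decide
    label₁ := by decide
    label₂ := by decide
    sorted := by decide }

/-- An HDA with eleven squares, in which the squares `z₁, …, z₇` form the product-like middle part and
`z₈, z₉` and `z₁₀, z₁₁` are two wings attached at `x₆` and `x₇`. Edge number `k - 1` is `y_k` and
square number `k - 1` is `z_k`. The square `z₄` is labelled `cc`. -/
def X₃ : LHDA Letter := SquareData.toLHDA
  { nV := 24, nE := 34, nQ := 11, init := 0
    edge := ![(0, 1, a), (0, 2, b), (1, 3, c), (1, 4, b), (2, 4, a), (2, 5, c), (3, 6, b), (4, 6, c),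
      (4, 7, c), (5, 7, a), (6, 8, d), (6, 9, c), (7, 9, c), (7, 10, e), (8, 11, c), (9, 11, d),
      (9, 12, e), (10, 12, c), (11, 13, e), (12, 13, d),
      (6, 14, e), (6, 15, c), (14, 16, c), (15, 16, e), (15, 17, d), (16, 18, d), (17, 18, e),
      (7, 19, d), (7, 20, c), (19, 21, c), (20, 21, d), (20, 22, e), (21, 23, e), (22, 23, d)]
    square := ![(0, 1, 4, 3), (3, 2, 6, 7), (4, 5, 9, 8), (7, 8, 12, 11), (11, 10, 14, 15),
      (12, 13, 17, 16), (15, 16, 19, 18), (21, 20, 22, 23), (24, 23, 25, 26), (28, 27, 29, 30),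
      (30, 31, 33, 32)]
    corner₀₀ := by decide
    corner₁₀ := by decide
    corner₀₁ := by decide
    corner₁₁ := by decide
    label₁ := by decide
    label₂ := by decide
    sorted := by decide }

/-- The same as `X₃` with the labels `d` and `e` exchanged. -/
def X₃' : LHDA Letter := SquareData.toLHDA
  { nV := 24, nE := 34, nQ := 11, init := 0
    edge := ![(0, 1, a), (0, 2, b), (1, 3, c), (1, 4, b), (2, 4, a), (2, 5, c), (3, 6, b), (4, 6, c),
      (4, 7, c), (5, 7, a), (6, 8, e), (6, 9, c), (7, 9, c), (7, 10, d), (8, 11, c), (9, 11, e),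
      (9, 12, d), (10, 12, c), (11, 13, d), (12, 13, e),
      (6, 14, d), (6, 15, c), (14, 16, c), (15, 16, d), (15, 17, e), (16, 18, e), (17, 18, d),
      (7, 19, e), (7, 20, c), (19, 21, c), (20, 21, e), (20, 22, d), (21, 23, d), (22, 23, e)]
    square := ![(0, 1, 4, 3), (3, 2, 6, 7), (4, 5, 9, 8), (7, 8, 12, 11), (11, 10, 14, 15),
      (12, 13, 17, 16), (16, 15, 18, 19), (21, 20, 22, 23), (23, 24, 26, 25), (28, 27, 29, 30),
      (31, 30, 32, 33)]
    corner₀₀ := by decide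
    corner₁₀ := by decide
    corner₀₁ := by decide
    corner₁₁ := by decide
    label₁ := by decide
    label₂ := by decide
    sorted := by decide }

end Example

/-!
Openness of a morphism in `HDAh` is a statement about path objects, but it amounts to a local lifting
property: a morphism of unfoldings is open if and only if every extension of the image of a cube along a
lower face lifts (`HDAh.isOpen_iff`). Indeed path objects are isomorphic to their own unfoldings
(`HDA.IsPathObject.exists_section`), path extensions are compositions of the extensions by one step, and
a path object for a longer path is obtained from one for a shorter path by freely adding a cube
(`HDA.freeStart`) or by doing nothing, since upper faces are there already.

As unfoldings project to the original HDA, with the same lifting property, a homotopy bisimulation gives a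
span of label-preserving morphisms of HDA with this lifting property
(`LHDA.HomotopyBisimilar.exists_span`). The images of paths under such a span form an ST-bisimulation,
so homotopy bisimilarity implies ST-bisimilarity. Conversely, a label-preserving morphism
of HDA with the lifting property is a homotopy bisimulation, and a span is a history-preserving
bisimulation if moreover squares lift between consecutive edges. In the latter case it suffices to lift
at a subset of the cubes that contains enough of the lifts
(`LHDA.historyPreservingBisimilar_of_span`). This reduces the positive results to finite checks.

* `X₁` folds onto `X₁'`. No path adjacent to the path `a`, `b` through the branch of `X₁` exchanges the
  end of `a` and the start of `b`, whereas in `X₁'` there always is one, through the square.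
* The additional `ab`-square of `X₂` can be matched with each of the two `ab`-squares of `X₂'`, depending on
  whether a path starts with `a` or with `b`. It cannot be matched with a single one of them, as both have
  a lower edge that is shared with a square that involves `c`.
* In `X₃` the two `c` in the square `cc` enable different squares once one of them has ended. Split traces
  do not tell which `c` has ended, ST-traces do: there is a path in `X₃` with an ST-trace that
  `X₃'` does not have.
-/

/-! ### Cube paths under morphisms -/

namespace HDA

variable {W X Y Z : HDA.{u}}

theorem hom_ext {f g : X ⟶ Y} (h : ∀ (n : ℕ) (x : X.cell n), f.map x = g.map x) : f = g :=
  Hom.ext (by funext n x; exact h n x)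

namespace CubePath

theorem shape_cast {n : ℕ} {x x' : X.cell n} (h : x = x') (ρ : CubePath X n x) :
    (h ▸ ρ).shape = ρ.shape := by
  subst h; rfl

theorem length_cast {n : ℕ} {x x' : X.cell n} (h : x = x') (ρ : CubePath X n x) :
    (h ▸ ρ).length = ρ.length := by
  subst h; rfl

theorem map_cast (f : X ⟶ Y) {n : ℕ} {x x' : X.cell n} (h : x = x') (ρ : CubePath X n x) :
    (h ▸ ρ).map f = (congrArg f.map h) ▸ ρ.map f := by
  subst h; rfl

@[simp]
theorem shape_map (f : X ⟶ Y) {n : ℕ} {x : X.cell n} (ρ : CubePath X n x) :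
    (ρ.map f).shape = ρ.shape := by
  induction ρ with
  | nil => exact shape_cast _ _
  | start ρ k y h ih => simp [map, shape, ih]
  | finish ρ k y h ih => simp [map, shape, ih]

@[simp]
theorem length_map (f : X ⟶ Y) {n : ℕ} {x : X.cell n} (ρ : CubePath X n x) :
    (ρ.map f).length = ρ.length := by
  induction ρ with
  | nil => exact length_cast _ _
  | start ρ k y h ih => simp [map, length, ih]
  | finish ρ k y h ih => simp [map, length, ih]

theorem map_comp (f : X ⟶ Y) (g : Y ⟶ Z) {n : ℕ} {x : X.cell n} (ρ : CubePath X n x) :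
    ρ.map (f ≫ g) = (ρ.map f).map g := by
  induction ρ with
  | nil =>
    refine Eq.trans ?_ (map_cast g (Hom.map_pt f).symm nil).symm
    exact (rec_trans_nil _ _)
  | start ρ k y h ih => simp only [map]; rw [ih]; rfl
  | finish ρ k y h ih => simp only [map]; rw [ih]; rfl
where
  rec_trans_nil {z z' : Z.cell 0} (h : Z.pt = z) (h' : z = z') :
      ((h.trans h') ▸ nil : CubePath Z 0 z') = h' ▸ (h ▸ nil : CubePath Z 0 z) := by
    subst h h'; rfl

theorem map_id {n : ℕ} {x : X.cell n} (ρ : CubePath X n x) : ρ.map (𝟙 X) = ρ := by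
  induction ρ with
  | nil => rfl
  | start ρ k y h ih => simp only [map]; rw [ih]; rfl
  | finish ρ k y h ih => simp only [map]; rw [ih]; rfl

theorem AdjOneWay.map (f : X ⟶ Y) {p n : ℕ} {x : X.cell n} {ρ σ : CubePath X n x}
    (h : AdjOneWay p ρ σ) : AdjOneWay p (ρ.map f) (σ.map f) := by
  induction h with
  | startStart ρ k l hkl => rw [← length_map f]; exact .startStart (ρ.map f) k l hkl ..
  | finishFinish ρ k l hkl => rw [← length_map f]; exact .finishFinish (ρ.map f) k l hkl ..
  | startFinish ρ k l hkl x y =>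
    rw [← length_map f]; exact .startFinish (ρ.map f) k l hkl _ (f.map y) ..
  | startFinish' ρ k l hkl x y =>
    rw [← length_map f]; exact .startFinish' (ρ.map f) k l hkl _ (f.map y) ..
  | congrStart _ k x h ih => exact ih.congrStart k _ _
  | congrFinish _ k x h ih => exact ih.congrFinish k _ _

theorem AdjOneWay.add_two_le_length {p n : ℕ} {x : X.cell n}
    {ρ σ : CubePath X n x} (h : AdjOneWay p ρ σ) : p + 2 ≤ ρ.length ∧ p + 2 ≤ σ.length := by
  induction h <;> simp only [length] <;> omega

end CubePath

namespace Path

theorem map_comp (f : X ⟶ Y) (g : Y ⟶ Z) (ρ : Path X) : ρ.map (f ≫ g) = (ρ.map f).map g := by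
  obtain ⟨n, x, ρ⟩ := ρ
  simp only [map]
  rw [CubePath.map_comp]
  rfl

@[simp]
theorem map_id (ρ : Path X) : ρ.map (𝟙 X) = ρ := by
  obtain ⟨n, x, ρ⟩ := ρ
  simp only [map]
  rw [CubePath.map_id]
  rfl

theorem map_nil (f : X ⟶ Y) : (nil X).map f = nil Y := by
  have : ∀ (y : Y.cell 0) (h : Y.pt = y), (⟨0, y, h ▸ CubePath.nil⟩ : Path Y) = nil Y := by
    rintro _ rfl; rfl
  exact this _ (Hom.map_pt f).symm

theorem mk_start_congr {n : ℕ} {x x' : X.cell n} {ρ : CubePath X n x} {ρ' : CubePath X n x'}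
    (hρ : (⟨n, x, ρ⟩ : Path X) = ⟨n, x', ρ'⟩) (k : Fin (n + 1)) {y y' : X.cell (n + 1)}
    (hy : y = y') (h h') :
    (⟨n + 1, y, ρ.start k y h⟩ : Path X) = ⟨n + 1, y', ρ'.start k y' h'⟩ := by
  cases hρ; subst hy; rfl

theorem mk_finish_congr {n : ℕ} {x x' : X.cell (n + 1)} {ρ : CubePath X (n + 1) x}
    {ρ' : CubePath X (n + 1) x'} (hρ : (⟨n + 1, x, ρ⟩ : Path X) = ⟨n + 1, x', ρ'⟩)
    (k : Fin (n + 1)) {y y' : X.cell n} (hy : y = y') (h h') :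
    (⟨n, y, ρ.finish k y h⟩ : Path X) = ⟨n, y', ρ'.finish k y' h'⟩ := by
  cases hρ; subst hy; rfl

theorem eq_start_of_map_eq {f : W ⟶ X} {ω : Path W} {n : ℕ} {x : X.cell n} {τ : CubePath X n x}
    {k : Fin (n + 1)} {y : X.cell (n + 1)} {h} (hω : ω.map f = ⟨n + 1, y, τ.start k y h⟩) :
    ∃ (v : W.cell n) (ω' : CubePath W n v) (w : W.cell (n + 1)) (h' : W.δ k false w = v),
      ω = ⟨n + 1, w, ω'.start k w h'⟩ ∧ f.map w = y ∧
        (⟨n, v, ω'⟩ : Path W).map f = ⟨n, x, τ⟩ := by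
  obtain ⟨m, w, ω⟩ := ω
  cases ω with
  | nil => cases (map_nil f).symm.trans hω
  | start ω k w h' =>
    cases hω
    exact ⟨_, ω, w, h', rfl, rfl, rfl⟩
  | finish ω k w h' =>
    simp only [map, CubePath.map] at hω
    cases hω

theorem eq_finish_of_map_eq {f : W ⟶ X} {ω : Path W} {n : ℕ} {x : X.cell (n + 1)}
    {τ : CubePath X (n + 1) x} {k : Fin (n + 1)} {y : X.cell n} {h}
    (hω : ω.map f = ⟨n, y, τ.finish k y h⟩) :
    ∃ (v : W.cell (n + 1)) (ω' : CubePath W (n + 1) v) (w : W.cell n) (h' : W.δ k true v = w),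
      ω = ⟨n, w, ω'.finish k w h'⟩ ∧ f.map w = y ∧
        (⟨n + 1, v, ω'⟩ : Path W).map f = ⟨n + 1, x, τ⟩ := by
  obtain ⟨m, w, ω⟩ := ω
  cases ω with
  | nil => cases (map_nil f).symm.trans hω
  | start ω k w h' => cases hω
  | finish ω k w h' =>
    cases hω
    exact ⟨_, ω, w, h', rfl, rfl, rfl⟩

theorem Step.unique {ρ σ τ : Path X} (h : ρ.Step τ) (h' : σ.Step τ) : ρ = σ := by
  cases h <;> cases h' <;> rfl

theorem Step.map (f : X ⟶ Y) {ρ σ : Path X} (h : ρ.Step σ) : (ρ.map f).Step (σ.map f) := by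
  cases h
  · exact .start ..
  · exact .finish ..

theorem AdjAt.map (f : X ⟶ Y) {p : ℕ} {ρ σ : Path X} (h : AdjAt p ρ σ) :
    AdjAt p (ρ.map f) (σ.map f) := by
  obtain ⟨h | h⟩ := h
  · exact .mk (.inl (h.map f))
  · exact .mk (.inr (h.map f))

end Path

end HDA

namespace HDA

variable {W X Y Z : HDA.{u}}

/-! ### Morphisms into unfoldings -/

/-- A cube of the unfolding is determined by its last cube together with any one of its lower faces. -/
theorem UnfoldCell.ext_of_lower {n : ℕ} {a b : UnfoldCell X (n + 1)} (k : Fin (n + 1))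
    (h : a.1 = b.1) (hk : face k false a = face k false b) : a = b := by
  induction a using UnfoldCell.ind with
  | h x ρ =>
    induction b using UnfoldCell.ind with
    | h y σ =>
      obtain rfl : x = y := h
      rw [face_false_mk, face_false_mk] at hk
      have hl : (ρ.lower k).Homotopic (σ.lower k) :=
        Quotient.exact (s := CubePath.homotopySetoid X _ _) (eq_of_heq (Sigma.mk.inj hk).2)
      exact mk_eq ((CubePath.start_lower ρ k).symm.trans
        ((hl.start k x rfl).trans (CubePath.start_lower σ k)))

/-- The unfolding of `Y` is a covering of `Y`: morphisms from an unfolding, all of whose cubes can be reached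
from the point, are determined by their projections. -/
theorem unfold_hom_ext {f g : unfold X ⟶ unfold Y} (h : f ≫ proj Y = g ≫ proj Y) : f = g := by
  have hp : ∀ (n : ℕ) (a : (unfold X).cell n), (f.map a).1 = (g.map a).1 := fun n a =>
    congrArg (fun t : unfold X ⟶ Y => t.map a) h
  have key : ∀ (n : ℕ) (x : X.cell n) (ρ : CubePath X n x),
      f.map (X := unfold X) (UnfoldCell.mk ρ) = g.map (X := unfold X) (UnfoldCell.mk ρ) := by
    intro n x ρ
    induction ρ with
    | nil => exact (Hom.map_pt f).trans (Hom.map_pt g).symm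
    | start ρ k y h ih =>
      refine UnfoldCell.ext_of_lower k (hp _ _) ?_
      have hl : (unfold X).δ k false (UnfoldCell.mk (ρ.start k y h)) = UnfoldCell.mk ρ :=
        UnfoldCell.face_false ρ (ρ.start k y h) k h .refl
      have hf := Hom.map_δ f k false (UnfoldCell.mk (ρ.start k y h))
      have hg := Hom.map_δ g k false (UnfoldCell.mk (ρ.start k y h))
      rw [hl] at hf hg
      exact hf.symm.trans (ih.trans hg)
    | finish ρ k x h ih =>
      have hl : (unfold X).δ k true (UnfoldCell.mk ρ) = UnfoldCell.mk (ρ.finish k x h) :=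
        UnfoldCell.face_true ρ k h
      have hf := Hom.map_δ f k true (UnfoldCell.mk ρ)
      have hg := Hom.map_δ g k true (UnfoldCell.mk ρ)
      rw [hl] at hf hg
      rw [hf, hg, ih]
  refine hom_ext fun n a => ?_
  induction a using UnfoldCell.ind with
  | h x ρ => exact key n x ρ

theorem unfoldMap_proj (f : X ⟶ Y) : unfoldMap f ≫ proj Y = proj X ≫ f := rfl

theorem unfoldMap_comp (f : X ⟶ Y) (g : Y ⟶ Z) :
    unfoldMap (f ≫ g) = unfoldMap f ≫ unfoldMap g := unfold_hom_ext rfl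

/-- Morphisms commute with the inverses of the projections from the unfoldings, if there are any. -/
theorem section_naturality {s : X ⟶ unfold X} {s' : Y ⟶ unfold Y} {f : X ⟶ Y}
    (hs : s ≫ proj X = 𝟙 X) (hs' : proj Y ≫ s' = 𝟙 (unfold Y)) :
    f ≫ s' = s ≫ unfoldMap f := by
  rw [← Category.comp_id (s ≫ unfoldMap f), ← hs', Category.assoc, ← Category.assoc (unfoldMap f),
    unfoldMap_proj, Category.assoc, ← Category.assoc s, hs, Category.id_comp]

/-- The path of the classes of all prefixes of a cube path. -/
noncomputable def CubePath.toUnfold : ∀ {n : ℕ} {x : X.cell n} (ρ : CubePath X n x),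
    CubePath (unfold X) n (UnfoldCell.mk ρ)
  | _, _, nil => nil
  | _, _, start ρ k y h => start ρ.toUnfold k _ (UnfoldCell.face_false _ _ k h .refl)
  | _, _, finish ρ k _ h => finish ρ.toUnfold k _ (UnfoldCell.face_true ρ k h)

theorem CubePath.shape_toUnfold {n : ℕ} {x : X.cell n} (ρ : CubePath X n x) :
    ρ.toUnfold.shape = ρ.shape := by
  induction ρ with
  | nil => rfl
  | start ρ k y h ih => simp [toUnfold, shape, ih]
  | finish ρ k y h ih => simp [toUnfold, shape, ih]

theorem CubePath.map_proj_toUnfold {n : ℕ} {x : X.cell n} (ρ : CubePath X n x) :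
    ρ.toUnfold.map (proj X) = ρ := by
  induction ρ with
  | nil => rfl
  | start ρ k y h ih => simp only [toUnfold, map]; rw [ih]; rfl
  | finish ρ k y h ih => simp only [toUnfold, map]; rw [ih]; rfl

/-! ### Lifting of lower faces -/

/-- Every cube of `Y` that extends the image of a cube of `X` along a lower face lifts to `X`. For
morphisms of unfoldings, this is openness, see `HDAh.isOpen_iff`. -/
def LiftsStarts (f : X ⟶ Y) : Prop :=
  ∀ (n : ℕ) (x : X.cell n) (k : Fin (n + 1)) (y : Y.cell (n + 1)), Y.δ k false y = f.map x →
    ∃ x', X.δ k false x' = x ∧ f.map x' = y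

theorem LiftsStarts.comp {f : X ⟶ Y} {g : Y ⟶ Z} (hf : LiftsStarts f) (hg : LiftsStarts g) :
    LiftsStarts (f ≫ g) := by
  intro n x k z hz
  obtain ⟨y, hy, rfl⟩ := hg n (f.map x) k z hz
  obtain ⟨x', hx, rfl⟩ := hf n x k y hy
  exact ⟨x', hx, rfl⟩

theorem liftsStarts_proj : LiftsStarts (proj X) := by
  intro n a k y hy
  induction a using UnfoldCell.ind with
  | h x ρ => exact ⟨UnfoldCell.mk (ρ.start k y hy), UnfoldCell.face_false _ _ k hy .refl, rfl⟩

/-- Two cubes of the unfolding with a common lower face and the same projection are equal, so lifts can be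
compared after projection. -/
theorem LiftsStarts.of_comp_proj {f : X ⟶ unfold Y} (h : LiftsStarts (f ≫ proj Y)) :
    LiftsStarts f := by
  intro n x k b hb
  obtain ⟨x', hx, hy⟩ := h n x k b.1 (congrArg Sigma.fst hb)
  refine ⟨x', hx, UnfoldCell.ext_of_lower k hy (.trans ?_ hb.symm)⟩
  rw [← hx]
  exact (Hom.map_δ f k false x').symm

theorem LiftsStarts.unfoldMap {f : X ⟶ Y} (h : LiftsStarts f) : LiftsStarts (unfoldMap f) :=
  .of_comp_proj (liftsStarts_proj.comp h)

/-- Extensions of the image of a path by one step lift to the path. -/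
theorem LiftsStarts.exists_step {f : X ⟶ Y} (hf : LiftsStarts f) {α : Path X} {β : Path Y}
    (h : (α.map f).Step β) : ∃ α', α.Step α' ∧ α'.map f = β := by
  obtain ⟨n, x, α⟩ := α
  cases h with
  | start _ k y h =>
    obtain ⟨x', h', rfl⟩ := hf _ x k y h
    exact ⟨_, .start α k x' h', rfl⟩
  | finish _ k y h =>
    subst h
    exact ⟨_, .finish α k _ rfl, Path.mk_finish_congr rfl k (Hom.map_δ f k true x) _ _⟩

/-! ### Path objects -/

theorem IsPathObject.hom_ext {P : HDA.{u}} {τ : Path P} (hP : IsPathObject P τ) {f g : P ⟶ Y}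
    (h : τ.map f = τ.map g) : f = g := by
  obtain ⟨_, _, hu⟩ := hP Y (τ.map g) (CubePath.shape_map g _)
  rw [hu f h, hu g rfl]

/-- A path object is isomorphic to its own unfolding. -/
theorem IsPathObject.exists_section {P : HDA.{u}} {τ : Path P} (hP : IsPathObject P τ) :
    ∃ s : P ⟶ unfold P, s ≫ proj P = 𝟙 P ∧ proj P ≫ s = 𝟙 (unfold P) := by
  obtain ⟨s, hs, _⟩ := hP (unfold P) ⟨_, _, τ.path.toUnfold⟩ (CubePath.shape_toUnfold _)
  have h : s ≫ proj P = 𝟙 P := by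
    refine hP.hom_ext ?_
    rw [Path.map_comp, hs, Path.map_id]
    simp only [Path.map]
    rw [CubePath.map_proj_toUnfold]
    rfl
  refine ⟨s, h, unfold_hom_ext ?_⟩
  rw [Category.assoc, h]
  rfl

/-- The path object with one vertex. -/
def point : HDA.{u} where
  cell
    | 0 => PUnit
    | _ + 1 => PEmpty
  δ _ _ x := x.elim
  δ_δ _ _ _ _ x _ := x.elim
  pt := PUnit.unit

theorem isPathObject_point : IsPathObject point.{u} ⟨0, PUnit.unit, .nil⟩ := by
  intro Y σ hσ
  obtain rfl : σ = Path.nil Y := by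
    obtain ⟨n, y, σ⟩ := σ
    cases σ with
    | nil => rfl
    | start σ k y h => simp [CubePath.shape] at hσ
    | finish σ k y h => simp [CubePath.shape] at hσ
  let f : point.{u} ⟶ Y :=
    { map := fun {n} x => match n, x with
        | 0, _ => Y.pt
        | _ + 1, x => x.elim
      map_δ := fun _ _ x => x.elim
      map_pt := rfl }
  refine ⟨f, Path.map_nil f, fun g _ => hom_ext fun n x => ?_⟩
  match n, x with
  | 0, _ => exact Hom.map_pt g
  | _ + 1, x => exact x.elim

section FreeStart

variable {P : HDA.{u}} {n : ℕ}

/-- Expressions for the cubes of the HDA obtained from `P` by freely adding an `n + 1`-cube. -/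
inductive StartTerm (P : HDA.{u}) (n : ℕ) : ℕ → Type u
  | old {m : ℕ} (c : P.cell m) : StartTerm P n m
  | new : StartTerm P n (n + 1)
  | face {m : ℕ} (k : Fin (m + 1)) (ν : Bool) (t : StartTerm P n (m + 1)) : StartTerm P n m

/-- The relation generating equality of expressions, if the lower face of the new cube in direction `k`
is to be `x`. -/
inductive StartRel (x : P.cell n) (k : Fin (n + 1)) : ∀ {m : ℕ}, StartTerm P n m →
    StartTerm P n m → Prop
  | glue : StartRel x k (.face k false .new) (.old x)
  | face_old {m : ℕ} (j : Fin (m + 1)) (ν : Bool) (c : P.cell (m + 1)) :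
      StartRel x k (.face j ν (.old c)) (.old (P.δ j ν c))
  | face_face {m : ℕ} (i j : Fin (m + 1)) (ν μ : Bool) (t : StartTerm P n (m + 2)) (h : i ≤ j) :
      StartRel x k (.face i ν (.face j.succ μ t)) (.face j μ (.face i.castSucc ν t))
  | face_congr {m : ℕ} (j : Fin (m + 1)) (ν : Bool) {s t : StartTerm P n (m + 1)}
      (h : StartRel x k s t) : StartRel x k (.face j ν s) (.face j ν t)

variable (x : P.cell n) (k : Fin (n + 1))

/-- The HDA obtained from `P` by freely adding a cube whose lower face in direction `k` is `x`. -/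
def freeStart : HDA.{u} where
  cell m := Quot (StartRel x k (m := m))
  δ j ν := Quot.map (.face j ν) fun _ _ h => .face_congr j ν h
  δ_δ i j ν μ t h := by
    induction t using Quot.ind with
    | mk t => exact Quot.sound (.face_face i j ν μ t h)
  pt := Quot.mk _ (.old P.pt)

namespace freeStart

/-- The inclusion of `P`. -/
def incl : P ⟶ freeStart x k where
  map c := Quot.mk _ (.old c)
  map_δ j ν c := (Quot.sound (.face_old j ν c)).symm
  map_pt := rfl

/-- The added cube. -/
def new : (freeStart x k).cell (n + 1) := Quot.mk _ .new

theorem δ_new : (freeStart x k).δ k false (new x k) = (incl x k).map x := Quot.sound .glue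

variable {x k}

/-- Evaluation of an expression in an HDA. -/
def eval (f : P ⟶ Y) (y : Y.cell (n + 1)) : ∀ {m : ℕ}, StartTerm P n m → Y.cell m
  | _, .old c => f.map c
  | _, .new => y
  | _, .face j ν t => Y.δ j ν (eval f y t)

theorem eval_congr (f : P ⟶ Y) (y : Y.cell (n + 1)) (hy : Y.δ k false y = f.map x) {m : ℕ}
    {s t : StartTerm P n m} (h : StartRel x k s t) : eval f y s = eval f y t := by
  induction h with
  | glue => exact hy
  | face_old j ν c => exact (Hom.map_δ f j ν c).symm
  | face_face i j ν μ t h => exact Y.δ_δ i j ν μ _ h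
  | face_congr j ν _ ih => exact congrArg (Y.δ j ν) ih

/-- The morphism given by a morphism of `P` and an image of the added cube. -/
def desc (f : P ⟶ Y) (y : Y.cell (n + 1)) (hy : Y.δ k false y = f.map x) : freeStart x k ⟶ Y where
  map := Quot.lift (eval f y) fun _ _ => eval_congr f y hy
  map_δ j ν t := by
    induction t using Quot.ind with
    | mk t => rfl
  map_pt := Hom.map_pt f

theorem hom_ext {f g : freeStart x k ⟶ Y} (h : incl x k ≫ f = incl x k ≫ g)
    (hnew : f.map (new x k) = g.map (new x k)) : f = g := by
  refine HDA.hom_ext fun m t => ?_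
  induction t using Quot.ind with
  | mk t =>
    induction t with
    | old c => exact congrArg (fun t : P ⟶ Y => t.map c) h
    | new => exact hnew
    | face j ν t ih =>
      exact (Hom.map_δ f j ν (Quot.mk _ t)).trans
        ((congrArg (Y.δ j ν) ih).trans (Hom.map_δ g j ν (Quot.mk _ t)).symm)

end freeStart

theorem IsPathObject.start {τ : CubePath P n x} (hP : IsPathObject P ⟨n, x, τ⟩) :
    IsPathObject (freeStart x k) ⟨n + 1, freeStart.new x k,
      (τ.map (freeStart.incl x k)).start k _ (freeStart.δ_new x k)⟩ := by
  rintro Y ⟨m, y, σ⟩ hσ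
  cases σ with
  | nil => simp [CubePath.shape] at hσ
  | finish σ k y h => simp [CubePath.shape] at hσ
  | start σ k' y h =>
    simp only [CubePath.shape, CubePath.shape_map] at hσ
    obtain ⟨hσ, hk⟩ := List.append_inj' hσ rfl
    obtain ⟨f, hf, hu⟩ := hP Y ⟨_, _, σ⟩ hσ
    cases hf
    obtain rfl : k' = k := Fin.ext (by simpa using hk)
    have hd : freeStart.incl x k' ≫ freeStart.desc f y h = f := rfl
    refine ⟨freeStart.desc f y h, Path.mk_start_congr ?_ k' rfl _ _, fun g hg => ?_⟩
    · exact (Path.map_comp (freeStart.incl x k') (freeStart.desc f y h) ⟨n, x, τ⟩).symm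
    · obtain ⟨_, _, _, _, hω, hy, hτ⟩ := Path.eq_start_of_map_eq hg
      cases hω
      refine freeStart.hom_ext ?_ hy
      rw [hd]
      exact hu _ ((Path.map_comp _ _ (⟨n, x, τ⟩ : Path P)).trans hτ)

theorem IsPathObject.finish {x : P.cell (n + 1)} {τ : CubePath P (n + 1) x}
    (hP : IsPathObject P ⟨n + 1, x, τ⟩) (k : Fin (n + 1)) :
    IsPathObject P ⟨n, P.δ k true x, τ.finish k _ rfl⟩ := by
  rintro Y ⟨m, y, σ⟩ hσ
  cases σ with
  | nil => simp [CubePath.shape] at hσ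
  | start σ k y h => simp [CubePath.shape] at hσ
  | finish σ k' y h =>
    simp only [CubePath.shape] at hσ
    obtain ⟨hσ, hk⟩ := List.append_inj' hσ rfl
    obtain ⟨f, hf, hu⟩ := hP Y ⟨_, _, σ⟩ hσ
    cases hf
    obtain rfl : k' = k := Fin.ext (by simpa using hk)
    refine ⟨f, Path.mk_finish_congr rfl k' ((Hom.map_δ f k' true x).trans h) _ _, fun g hg => ?_⟩
    obtain ⟨_, _, _, _, hω, _, hτ⟩ := Path.eq_finish_of_map_eq hg
    cases hω
    exact hu g hτ

end FreeStart

/-- Every cube path is the image of the generating path of some path object. -/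
theorem exists_isPathObject {n : ℕ} {x : X.cell n} (ρ : CubePath X n x) :
    ∃ (P : HDA.{u}) (t : P.cell n) (τ : CubePath P n t), IsPathObject P ⟨n, t, τ⟩ ∧
      τ.shape = ρ.shape := by
  induction ρ with
  | nil => exact ⟨point, _, _, isPathObject_point, rfl⟩
  | start ρ k y h ih =>
    obtain ⟨P, t, τ, hP, hs⟩ := ih
    exact ⟨_, _, _, hP.start t k, by simp [CubePath.shape, hs]⟩
  | finish ρ k y h ih =>
    obtain ⟨P, t, τ, hP, hs⟩ := ih
    exact ⟨_, _, _, hP.finish k, by simp [CubePath.shape, hs]⟩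

end HDA

/-! ### Open morphisms -/

namespace HDAh

open HDA

variable {X Y : HDAh.{u}}

theorem IsOpen.liftsStarts {f : X ⟶ Y} (hf : IsOpen f) : LiftsStarts f.hom := by
  intro n a k b hb
  induction a using UnfoldCell.ind with
  | h x ρ =>
    obtain ⟨P, t, τ, hP, hs⟩ := exists_isPathObject ρ
    obtain ⟨s, hs₁, hs₂⟩ := hP.exists_section
    have hQ := hP.start t k
    obtain ⟨s', hs'₁, hs'₂⟩ := hQ.exists_section
    -- the class of `ρ` is the image of the end of `τ` under `φ`
    obtain ⟨φ, hφ, _⟩ := hP (unfold X) ⟨_, _, ρ.toUnfold⟩ ((CubePath.shape_toUnfold ρ).trans hs.symm)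
    have hφt : φ.map t = UnfoldCell.mk ρ :=
      eq_of_heq (HDA.Path.mk.inj hφ).2.1
    let i : (show HDAh.{u} from P) ⟶ (show HDAh.{u} from freeStart t k) :=
      InducedCategory.homMk (unfoldMap (freeStart.incl t k))
    let φ' : (show HDAh.{u} from P) ⟶ X := InducedCategory.homMk (proj P ≫ φ)
    have hb' : Hom.map (φ ≫ f.hom) t = (unfold Y).δ k false b := by
      rw [hb, ← hφt]; rfl
    let ψ : (show HDAh.{u} from freeStart t k) ⟶ Y :=
      InducedCategory.homMk (proj _ ≫ freeStart.desc (φ ≫ f.hom) b hb'.symm)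
    have hi : HDPh i := by
      refine ⟨freeStart.incl t k, .extension _ _ hP hQ _ (.single ?_), rfl⟩
      exact .start (τ.map (freeStart.incl t k)) k _ (freeStart.δ_new t k)
    have sq : CommSq φ' i f ψ := ⟨InducedCategory.hom_ext rfl⟩
    have := hf i hi
    have e₁ : unfoldMap (freeStart.incl t k) ≫ sq.lift.hom = proj P ≫ φ :=
      congrArg InducedCategory.Hom.hom sq.fac_left
    have e₂ : sq.lift.hom ≫ f.hom = proj _ ≫ freeStart.desc (φ ≫ f.hom) b hb'.symm :=
      congrArg InducedCategory.Hom.hom sq.fac_right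
    have e₃ : freeStart.incl t k ≫ s' ≫ sq.lift.hom = φ := by
      rw [← Category.assoc, section_naturality hs₁ hs'₂, Category.assoc, e₁, ← Category.assoc, hs₁,
        Category.id_comp]
    have e₄ : (s' ≫ sq.lift.hom) ≫ f.hom = freeStart.desc (φ ≫ f.hom) b hb'.symm := by
      rw [Category.assoc, e₂, ← Category.assoc, hs'₁, Category.id_comp]
    refine ⟨Hom.map (s' ≫ sq.lift.hom) (freeStart.new t k), ?_, ?_⟩
    · rw [← Hom.map_δ, freeStart.δ_new, ← hφt]
      exact congrArg (fun g : P ⟶ unfold X => g.map t) e₃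
    · exact congrArg (fun g : freeStart t k ⟶ unfold Y => g.map (freeStart.new t k)) e₄

/-- Lifting along an extension of paths: the lifts of the additional steps give a path in `X`,
which defines a morphism because the target of the extension is free. -/
theorem exists_lift_of_isPrefix {X Y P Q : HDA.{u}} {h : X ⟶ Y} (hh : LiftsStarts h) {τ : Path P}
    {τ' : Path Q} (hP : IsPathObject P τ) (hQ : IsPathObject Q τ') {g : P ⟶ Q}
    (hg : (τ.map g).IsPrefix τ') {φ : P ⟶ X} {ψ : Q ⟶ Y} (hsq : φ ≫ h = g ≫ ψ) :
    ∃ χ : Q ⟶ X, g ≫ χ = φ ∧ χ ≫ h = ψ := by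
  obtain ⟨α, hα, hu⟩ : ∃ α : Path X, α.map h = τ'.map ψ ∧
      ∀ χ : Q ⟶ X, τ'.map χ = α → (τ.map g).map χ = τ.map φ := by
    clear hQ
    induction hg with
    | refl => exact ⟨τ.map φ, by rw [← Path.map_comp, ← Path.map_comp, hsq], fun χ hχ => hχ⟩
    | tail _ hst ih =>
      obtain ⟨α, hα, hu⟩ := ih
      obtain ⟨α', hs, hα'⟩ := hh.exists_step (hα ▸ hst.map ψ)
      exact ⟨α', hα', fun χ hχ => hu χ ((hχ ▸ hst.map χ).unique hs)⟩
  obtain ⟨χ, hχ, _⟩ := hQ X α (by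
    have := congrArg (fun ρ : Path Y => ρ.path.shape) hα
    exact (CubePath.shape_map h α.path).symm.trans (this.trans (CubePath.shape_map ψ τ'.path)))
  refine ⟨χ, hP.hom_ext ?_, hQ.hom_ext ?_⟩
  · rw [Path.map_comp, hu χ hχ]
  · rw [Path.map_comp, hχ, hα]

theorem hasLiftingProperty_of_isPathMorphism {f : X ⟶ Y} (hf : LiftsStarts f.hom) {P Q : HDA.{u}}
    {g : P ⟶ Q} (hg : IsPathMorphism g) :
    HasLiftingProperty (InducedCategory.homMk (unfoldMap g) :
      (show HDAh.{u} from P) ⟶ (show HDAh.{u} from Q)) f := by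
  induction hg with
  | @extension P Q τ τ' hP hQ g hg =>
    obtain ⟨s, hs₁, hs₂⟩ := hP.exists_section
    obtain ⟨s', hs'₁, hs'₂⟩ := hQ.exists_section
    refine ⟨fun {φ ψ} sq => ?_⟩
    have hsq : φ.hom ≫ f.hom = unfoldMap g ≫ ψ.hom := congrArg InducedCategory.Hom.hom sq.w
    obtain ⟨χ, h₁, h₂⟩ := exists_lift_of_isPrefix hf hP hQ hg
      (φ := s ≫ φ.hom) (ψ := s' ≫ ψ.hom) (by
        rw [Category.assoc, hsq, ← Category.assoc, ← Category.assoc, section_naturality hs₁ hs'₂])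
    refine ⟨⟨⟨InducedCategory.homMk (proj Q ≫ χ), InducedCategory.hom_ext ?_,
      InducedCategory.hom_ext ?_⟩⟩⟩
    · change unfoldMap g ≫ proj Q ≫ χ = φ.hom
      rw [← Category.assoc, unfoldMap_proj, Category.assoc, h₁, ← Category.assoc, hs₂,
        Category.id_comp]
    · change (proj Q ≫ χ) ≫ f.hom = ψ.hom
      rw [Category.assoc, h₂, ← Category.assoc, hs'₂, Category.id_comp]
  | iso τ τ' hP hQ g hg =>
    have : IsIso (InducedCategory.homMk (unfoldMap g) :
        (show HDAh.{u} from _) ⟶ (show HDAh.{u} from _)) := by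
      refine ⟨InducedCategory.homMk (unfoldMap (inv g)), InducedCategory.hom_ext ?_,
        InducedCategory.hom_ext ?_⟩
      · exact (unfoldMap_comp g (inv g)).symm.trans
          ((congrArg unfoldMap (IsIso.hom_inv_id g)).trans (unfold_hom_ext rfl))
      · exact (unfoldMap_comp (inv g) g).symm.trans
          ((congrArg unfoldMap (IsIso.inv_hom_id g)).trans (unfold_hom_ext rfl))
    infer_instance
  | comp g g' _ _ ih ih' =>
    rw [show InducedCategory.homMk (unfoldMap (g ≫ g')) = InducedCategory.homMk (unfoldMap g) ≫
      InducedCategory.homMk (unfoldMap g') from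
        InducedCategory.hom_ext (unfoldMap_comp g g')]
    infer_instance

/-- A morphism of `HDAh` is open if and only if it lifts cubes along lower faces. -/
theorem isOpen_iff {f : X ⟶ Y} : IsOpen f ↔ LiftsStarts f.hom := by
  refine ⟨IsOpen.liftsStarts, fun hf P Q g hg => ?_⟩
  obtain ⟨g', hg', hgg⟩ := hg
  obtain rfl : g = InducedCategory.homMk (unfoldMap g') := InducedCategory.hom_ext hgg
  exact hasLiftingProperty_of_isPathMorphism hf hg'

end HDAh

namespace HDA

variable {W X Y : HDA.{u}}

/-! ### Lifting steps and adjacencies -/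

/-- Lifting along lower faces for the cubes that satisfy `G`, with lifts that satisfy `G` again. -/
def LiftsStartsOn (G : ∀ {n : ℕ}, X.cell n → Prop) (f : X ⟶ Y) : Prop :=
  ∀ (n : ℕ) (x : X.cell n) (k : Fin (n + 1)) (y : Y.cell (n + 1)), G x →
    Y.δ k false y = f.map x → ∃ x', G x' ∧ X.δ k false x' = x ∧ f.map x' = y

/-- Every cube of `Y` two of whose faces, a lower and an upper one, are the images of two consecutive
cubes of `X` lifts to `X`. -/
def LiftsBetween (f : X ⟶ Y) : Prop :=
  ∀ (n : ℕ) (v w : X.cell (n + 1)) (i j : Fin (n + 1)) (k l : Fin (n + 2)) (y : Y.cell (n + 2)),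
    X.δ i true v = X.δ j false w → Y.δ k false y = f.map v → Y.δ l true y = f.map w →
    ∃ x, X.δ k false x = v ∧ X.δ l true x = w ∧ f.map x = y

/-- The relation between the images under `f` and `g` of the paths in `W` that end in a cube with the
property `G`. -/
def SpanRel (G : ∀ {n : ℕ}, W.cell n → Prop) (f : W ⟶ X) (g : W ⟶ Y)
    (ρ : Path X) (σ : Path Y) : Prop :=
  ∃ ω : Path W, G ω.last ∧ ω.map f = ρ ∧ ω.map g = σ

theorem LiftsStartsOn.exists_step {G : ∀ {n : ℕ}, X.cell n → Prop} {f : X ⟶ Y}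
    (hf : LiftsStartsOn G f) (hG : ∀ (n : ℕ) (x : X.cell (n + 1)) (k : Fin (n + 1)), G x →
      G (X.δ k true x)) {α : Path X} (hα : G α.last) {β : Path Y} (h : (α.map f).Step β) :
    ∃ α', α.Step α' ∧ G α'.last ∧ α'.map f = β := by
  obtain ⟨n, x, α⟩ := α
  cases h with
  | start _ k y h =>
    obtain ⟨x', hx', h', rfl⟩ := hf _ x k y hα h
    exact ⟨_, .start α k x' h', hx', rfl⟩
  | finish _ k y h =>
    subst h
    exact ⟨_, .finish α k _ rfl, hG _ _ k hα,
      Path.mk_finish_congr rfl k (Hom.map_δ f k true x) _ _⟩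

theorem LiftsStartsOn.liftsStarts {G : ∀ {n : ℕ}, X.cell n → Prop} {f : X ⟶ Y}
    (hf : LiftsStartsOn G f) (hG : ∀ (n : ℕ) (x : X.cell n), G x) : LiftsStarts f := by
  intro n x k y h
  obtain ⟨x', -, h⟩ := hf n x k y (hG n x) h
  exact ⟨x', h⟩

/-- Lifting of adjacencies from left to right; the exchange of a `finish` followed by a `start`
is the only one in which the new cube is not a face of a cube that is already there. -/
theorem CubePath.AdjOneWay.exists_lift {f : X ⟶ Y} (hf : LiftsBetween f)
    {p n : ℕ} {y : Y.cell n} {τ τ' : CubePath Y n y} (h : CubePath.AdjOneWay p τ τ') :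
    ∀ ω : Path X, ω.map f = ⟨n, y, τ⟩ → ∃ ω', Path.AdjAt p ω ω' ∧ ω'.map f = ⟨n, y, τ'⟩ := by
  induction h with
  | startStart τ k l hkl x y z h₁ h₂ h₃ h₄ =>
    intro ω hω
    obtain ⟨_, _, z, hz, rfl, rfl, hω₁⟩ := Path.eq_start_of_map_eq hω
    obtain ⟨v, ω, _, hx, hω₂, -, hω₃⟩ := Path.eq_start_of_map_eq hω₁
    cases hω₂
    cases hω₃
    subst hz h₄
    have hy : X.δ l false (X.δ k.castSucc false z) = v := by rw [← X.δ_δ k l _ _ z hkl, hx]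
    have h := CubePath.AdjOneWay.startStart ω k l hkl _ _ z hx rfl hy rfl
    rw [← CubePath.length_map f] at h
    exact ⟨_, .mk (.inl h), Path.mk_start_congr (Path.mk_start_congr rfl l
      (Hom.map_δ f _ _ z) (by rw [← Hom.map_δ f, hy]) _) k.castSucc rfl
      (Hom.map_δ f ..).symm _⟩
  | finishFinish τ k l hkl x y z h₁ h₂ h₃ h₄ =>
    intro ω hω
    obtain ⟨_, _, z, hz, rfl, rfl, hω₁⟩ := Path.eq_finish_of_map_eq hω
    obtain ⟨v, ω, _, hx, hω₂, -, hω₃⟩ := Path.eq_finish_of_map_eq hω₁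
    cases hω₂
    cases hω₃
    subst hx h₃
    have hy : X.δ l true (X.δ k.castSucc true v) = z := by rw [← X.δ_δ k l _ _ v hkl, hz]
    have h := CubePath.AdjOneWay.finishFinish ω k l hkl _ _ z rfl hz rfl hy
    rw [← CubePath.length_map f] at h
    exact ⟨_, .mk (.inl h), Path.mk_finish_congr (Path.mk_finish_congr rfl k.castSucc
      (Hom.map_δ f _ _ v) (Hom.map_δ f ..).symm _) l rfl (by rw [← Hom.map_δ f, hy]) _⟩
  | startFinish τ k l hkl x y z h₁ h₂ h₃ h₄ =>
    intro ω hω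
    obtain ⟨_, _, z, hz, rfl, rfl, hω₁⟩ := Path.eq_start_of_map_eq hω
    obtain ⟨v, ω, _, hx, hω₂, -, hω₃⟩ := Path.eq_finish_of_map_eq hω₁
    cases hω₂
    cases hω₃
    obtain ⟨y, hy, hy', rfl⟩ := hf _ v z l k _ _ y (hx.trans hz.symm) h₃ h₄
    have h := CubePath.AdjOneWay.startFinish ω k l hkl _ y z hx hz hy hy'
    rw [← CubePath.length_map f] at h
    exact ⟨_, .mk (.inl h), Path.mk_finish_congr (Path.mk_start_congr rfl k.castSucc
      (y' := f.map y) rfl (by rw [← Hom.map_δ f, hy]) _) l.succ rfl (by rw [← Hom.map_δ f, hy']) _⟩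
  | startFinish' τ k l hkl x y z h₁ h₂ h₃ h₄ =>
    intro ω hω
    obtain ⟨_, _, z, hz, rfl, rfl, hω₁⟩ := Path.eq_start_of_map_eq hω
    obtain ⟨v, ω, _, hx, hω₂, -, hω₃⟩ := Path.eq_finish_of_map_eq hω₁
    cases hω₂
    cases hω₃
    obtain ⟨y, hy, hy', rfl⟩ := hf _ v z k l _ _ y (hx.trans hz.symm) h₃ h₄
    have h := CubePath.AdjOneWay.startFinish' ω k l hkl _ y z hx hz hy hy'
    rw [← CubePath.length_map f] at h
    exact ⟨_, .mk (.inl h), Path.mk_finish_congr (Path.mk_start_congr rfl l.succ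
      (y' := f.map y) rfl (by rw [← Hom.map_δ f, hy]) _) k.castSucc rfl
      (by rw [← Hom.map_δ f, hy']) _⟩
  | congrStart h k x hx ih =>
    intro ω hω
    obtain ⟨v, ω, x, hv, rfl, rfl, hω₁⟩ := Path.eq_start_of_map_eq hω
    obtain ⟨ω', ⟨h | h⟩, hω'⟩ := ih _ hω₁
    · exact ⟨_, .mk (.inl (h.congrStart k x hv)), Path.mk_start_congr hω' k rfl _ _⟩
    · exact ⟨_, .mk (.inr (h.congrStart k x hv)), Path.mk_start_congr hω' k rfl _ _⟩
  | congrFinish h k x hx ih =>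
    intro ω hω
    obtain ⟨v, ω, x, hv, rfl, rfl, hω₁⟩ := Path.eq_finish_of_map_eq hω
    obtain ⟨ω', ⟨h | h⟩, hω'⟩ := ih _ hω₁
    · exact ⟨_, .mk (.inl (h.congrFinish k x hv)), Path.mk_finish_congr hω' k rfl _ _⟩
    · exact ⟨_, .mk (.inr (h.congrFinish k x hv)), Path.mk_finish_congr hω' k rfl _ _⟩

/-- Lifting of adjacencies from right to left, where the new cube is always a face of a cube that is
already there. -/
theorem CubePath.AdjOneWay.exists_lift_symm {f : X ⟶ Y}
    {p n : ℕ} {y : Y.cell n} {τ τ' : CubePath Y n y} (h : CubePath.AdjOneWay p τ τ') :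
    ∀ ω : Path X, ω.map f = ⟨n, y, τ'⟩ → ∃ ω', Path.AdjAt p ω ω' ∧ ω'.map f = ⟨n, y, τ⟩ := by
  induction h with
  | startStart τ k l hkl x y z h₁ h₂ h₃ h₄ =>
    intro ω hω
    obtain ⟨_, _, z, hz, rfl, rfl, hω₁⟩ := Path.eq_start_of_map_eq hω
    obtain ⟨v, ω, _, hx, hω₂, -, hω₃⟩ := Path.eq_start_of_map_eq hω₁
    cases hω₂
    cases hω₃
    subst hz h₂
    have hy : X.δ k false (X.δ l.succ false z) = v := by rw [X.δ_δ k l _ _ z hkl, hx]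
    have h := CubePath.AdjOneWay.startStart ω k l hkl _ _ z hy rfl hx rfl
    rw [← CubePath.length_map f] at h
    exact ⟨_, .mk (.inr h), Path.mk_start_congr (Path.mk_start_congr rfl k
      (Hom.map_δ f _ _ z) (by rw [← Hom.map_δ f, hy]) _) l.succ rfl
      (Hom.map_δ f ..).symm _⟩
  | finishFinish τ k l hkl x y z h₁ h₂ h₃ h₄ =>
    intro ω hω
    obtain ⟨_, _, z, hz, rfl, rfl, hω₁⟩ := Path.eq_finish_of_map_eq hω
    obtain ⟨v, ω, _, hx, hω₂, -, hω₃⟩ := Path.eq_finish_of_map_eq hω₁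
    cases hω₂
    cases hω₃
    subst hx h₁
    have hy : X.δ k true (X.δ l.succ true v) = z := by rw [X.δ_δ k l _ _ v hkl, hz]
    have h := CubePath.AdjOneWay.finishFinish ω k l hkl _ _ z rfl hy rfl hz
    rw [← CubePath.length_map f] at h
    exact ⟨_, .mk (.inr h), Path.mk_finish_congr (Path.mk_finish_congr rfl l.succ
      (Hom.map_δ f _ _ v) (Hom.map_δ f ..).symm _) k rfl (by rw [← Hom.map_δ f, hy]) _⟩
  | startFinish τ k l hkl x y z h₁ h₂ h₃ h₄ =>
    intro ω hω
    obtain ⟨w, _, z, hz, rfl, rfl, hω₁⟩ := Path.eq_finish_of_map_eq hω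
    obtain ⟨v, ω, _, hx, hω₂, -, hω₃⟩ := Path.eq_start_of_map_eq hω₁
    cases hω₂
    cases hω₃
    subst hx hz h₁
    have hy : X.δ k false (X.δ l.succ true w) = X.δ l true (X.δ k.castSucc false w) :=
      X.δ_δ k l _ _ w hkl
    have h := CubePath.AdjOneWay.startFinish ω k l hkl _ w _ rfl hy rfl rfl
    rw [← CubePath.length_map f] at h
    exact ⟨_, .mk (.inr h), Path.mk_start_congr (Path.mk_finish_congr rfl l
      (Hom.map_δ f _ _ _) (Hom.map_δ f ..).symm _) k rfl (by rw [← Hom.map_δ f, hy, Hom.map_δ f]) _⟩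
  | startFinish' τ k l hkl x y z h₁ h₂ h₃ h₄ =>
    intro ω hω
    obtain ⟨w, _, z, hz, rfl, rfl, hω₁⟩ := Path.eq_finish_of_map_eq hω
    obtain ⟨v, ω, _, hx, hω₂, -, hω₃⟩ := Path.eq_start_of_map_eq hω₁
    cases hω₂
    cases hω₃
    subst hx hz h₁
    have hy : X.δ l false (X.δ k.castSucc true w) = X.δ k true (X.δ l.succ false w) :=
      (X.δ_δ k l _ _ w hkl).symm
    have h := CubePath.AdjOneWay.startFinish' ω k l hkl _ w _ rfl hy rfl rfl
    rw [← CubePath.length_map f] at h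
    exact ⟨_, .mk (.inr h), Path.mk_start_congr (Path.mk_finish_congr rfl k
      (Hom.map_δ f _ _ _) (Hom.map_δ f ..).symm _) l rfl (by rw [← Hom.map_δ f, hy, Hom.map_δ f]) _⟩
  | congrStart h k x hx ih =>
    intro ω hω
    obtain ⟨v, ω, x, hv, rfl, rfl, hω₁⟩ := Path.eq_start_of_map_eq hω
    obtain ⟨ω', ⟨h | h⟩, hω'⟩ := ih _ hω₁
    · exact ⟨_, .mk (.inl (h.congrStart k x hv)), Path.mk_start_congr hω' k rfl _ _⟩
    · exact ⟨_, .mk (.inr (h.congrStart k x hv)), Path.mk_start_congr hω' k rfl _ _⟩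
  | congrFinish h k x hx ih =>
    intro ω hω
    obtain ⟨v, ω, x, hv, rfl, rfl, hω₁⟩ := Path.eq_finish_of_map_eq hω
    obtain ⟨ω', ⟨h | h⟩, hω'⟩ := ih _ hω₁
    · exact ⟨_, .mk (.inl (h.congrFinish k x hv)), Path.mk_finish_congr hω' k rfl _ _⟩
    · exact ⟨_, .mk (.inr (h.congrFinish k x hv)), Path.mk_finish_congr hω' k rfl _ _⟩

theorem LiftsBetween.exists_adjAt {f : X ⟶ Y} (hf : LiftsBetween f) {p : ℕ}
    {ω : Path X} {ρ : Path Y} (h : Path.AdjAt p (ω.map f) ρ) :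
    ∃ ω', Path.AdjAt p ω ω' ∧ ω'.map f = ρ := by
  obtain ⟨τ, hτ⟩ : ∃ τ, ω.map f = τ := ⟨_, rfl⟩
  rw [hτ] at h
  obtain ⟨h | h⟩ := h
  · exact h.exists_lift hf ω hτ
  · exact h.exists_lift_symm ω hτ

end HDA

namespace LHDA

open HDA

variable {S : Type u} [LinearOrder S] {X Y : LHDA S} {W : HDA.{u}}

/-! ### Traces -/

theorem started_map {X Y : HDA.{u}} (f : X ⟶ Y) {n : ℕ} {x : X.cell n} (ρ : CubePath X n x) :
    started (ρ.map f) = started ρ := by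
  induction ρ with
  | nil => exact funext fun i => i.elim0
  | start ρ k y h ih => simp [CubePath.map, started, ih]
  | finish ρ k y h ih => simp [CubePath.map, started, ih]

theorem stTrace_map_nil (f : W ⟶ X.toHDA) : X.stTrace ((CubePath.nil (X := W)).map f) = [] := by
  have : ∀ (x : X.cell 0) (h : X.pt = x), X.stTrace (h ▸ .nil : CubePath X.toHDA 0 x) = [] := by
    rintro _ rfl; rfl
  exact this _ _

/-- Two morphisms that induce the same labelling send every path to paths with equal ST-traces. -/
theorem stTrace_map_eq {f : W ⟶ X.toHDA} {g : W ⟶ Y.toHDA} (h : f ≫ X.lab = g ≫ Y.lab) {n : ℕ}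
    {w : W.cell n} (ω : CubePath W n w) : X.stTrace (ω.map f) = Y.stTrace (ω.map g) := by
  have hl : ∀ {n : ℕ} (w : W.cell n), X.lab.map (f.map w) = Y.lab.map (g.map w) := fun w =>
    congrArg (fun t : W ⟶ torus S => t.map w) h
  induction ω with
  | nil => rw [stTrace_map_nil, stTrace_map_nil]
  | start ω k y h ih => simp only [CubePath.map, stTrace, ih, hl]
  | finish ω k y h ih => simp only [CubePath.map, stTrace, ih, hl, started_map]

/-- Forgetting where a finished action was started. -/
def STAction.toSplitAction : STAction S → SplitAction S
  | .start a => .start a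
  | .finish a _ => .finish a

theorem map_stTrace {n : ℕ} {x : X.cell n} (ρ : CubePath X.toHDA n x) :
    (X.stTrace ρ).map STAction.toSplitAction = X.splitTrace ρ := by
  induction ρ with
  | nil => rfl
  | start ρ k y h ih => simp [stTrace, splitTrace, ih, STAction.toSplitAction]
  | finish ρ k y h ih => simp [stTrace, splitTrace, ih, STAction.toSplitAction]

theorem STBisimilar.splitBisimilar (h : STBisimilar X Y) : SplitBisimilar X Y := by
  obtain ⟨R, hR, ht⟩ := h
  exact ⟨R, hR, fun ρ σ hρσ => by rw [← map_stTrace, ht ρ σ hρσ, map_stTrace]⟩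

theorem HistoryPreservingBisimilar.stBisimilar (h : HistoryPreservingBisimilar X Y) :
    STBisimilar X Y := by
  obtain ⟨R, hR, ht, _⟩ := h
  exact ⟨R, hR, ht⟩

theorem IsPathBisimulation.exists_related {R : Path X.toHDA → Path Y.toHDA → Prop}
    (hR : IsPathBisimulation X Y R) {n : ℕ} {x : X.cell n} (ρ : CubePath X.toHDA n x) :
    ∃ σ, R ⟨n, x, ρ⟩ σ := by
  induction ρ with
  | nil => exact ⟨_, hR.init⟩
  | start ρ k y h ih =>
    obtain ⟨σ, hσ⟩ := ih
    obtain ⟨σ', -, hσ'⟩ := hR.forth _ _ _ hσ (.start ρ k y h)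
    exact ⟨σ', hσ'⟩
  | finish ρ k y h ih =>
    obtain ⟨σ, hσ⟩ := ih
    obtain ⟨σ', -, hσ'⟩ := hR.forth _ _ _ hσ (.finish ρ k y h)
    exact ⟨σ', hσ'⟩

theorem STBisimilar.exists_stTrace_eq (h : STBisimilar X Y) {n : ℕ} {x : X.cell n}
    (ρ : CubePath X.toHDA n x) : ∃ σ : Path Y.toHDA, Y.stTrace σ.path = X.stTrace ρ := by
  obtain ⟨R, hR, ht⟩ := h
  obtain ⟨σ, hσ⟩ := hR.exists_related ρ
  exact ⟨σ, (ht _ _ hσ).symm⟩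

theorem eq_nil_of_stTrace {σ : Path X.toHDA} (h : X.stTrace σ.path = []) : σ = Path.nil _ := by
  obtain ⟨n, x, σ⟩ := σ
  cases σ with
  | nil => rfl
  | start σ k y h' => simp [stTrace] at h
  | finish σ k y h' => simp [stTrace] at h

theorem eq_start_of_stTrace {σ : Path X.toHDA} {T : List (STAction S)} {a : S}
    (h : X.stTrace σ.path = T ++ [.start a]) :
    ∃ (n : ℕ) (x : X.cell n) (σ' : CubePath X.toHDA n x) (k : Fin (n + 1)) (y : X.cell (n + 1))
      (h' : X.δ k false y = x), σ = ⟨n + 1, y, σ'.start k y h'⟩ ∧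
        X.stTrace (⟨n, x, σ'⟩ : Path X.toHDA).path = T ∧ (X.lab.map y).1 k = a := by
  obtain ⟨n, x, σ⟩ := σ
  cases σ with
  | nil => simp [stTrace] at h
  | start σ k y h' =>
    obtain ⟨h, hl⟩ := List.append_inj' h rfl
    exact ⟨_, _, σ, k, _, h', rfl, h, by simpa using hl⟩
  | finish σ k y h' => simp [stTrace] at h

theorem eq_finish_of_stTrace {σ : Path X.toHDA} {T : List (STAction S)} {a : S} {j : ℕ}
    (h : X.stTrace σ.path = T ++ [.finish a j]) :
    ∃ (n : ℕ) (y : X.cell (n + 1)) (σ' : CubePath X.toHDA (n + 1) y) (k : Fin (n + 1)) (x : X.cell n)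
      (h' : X.δ k true y = x), σ = ⟨n, x, σ'.finish k x h'⟩ ∧
        X.stTrace (⟨n + 1, y, σ'⟩ : Path X.toHDA).path = T ∧ (X.lab.map y).1 k = a ∧
          started σ' k = j := by
  obtain ⟨n, x, σ⟩ := σ
  cases σ with
  | nil => simp [stTrace] at h
  | start σ k y h' => simp [stTrace] at h
  | finish σ k y h' =>
    obtain ⟨h, hl⟩ := List.append_inj' h rfl
    exact ⟨_, _, σ, k, _, h', rfl, h, by simpa using hl⟩

/-! ### Bisimulations from spans -/

/-- As `G` only concerns the last cube of a path, extensions of a path that satisfies `G` need to be lifted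
but prefixes do not have to satisfy `G`. -/
theorem isPathBisimulation_spanRel {G : ∀ {n : ℕ}, W.cell n → Prop} {f : W ⟶ X.toHDA}
    {g : W ⟶ Y.toHDA} (hf : LiftsStartsOn G f) (hg : LiftsStartsOn G g) (hpt : G W.pt)
    (hG : ∀ (n : ℕ) (w : W.cell (n + 1)) (k : Fin (n + 1)), G w → G (W.δ k true w)) :
    IsPathBisimulation X Y (SpanRel G f g) where
  init := ⟨Path.nil W, hpt, Path.map_nil f, Path.map_nil g⟩
  forth := by
    rintro _ _ ρ' ⟨ω, hω, rfl, rfl⟩ h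
    obtain ⟨ω', hs, hω', rfl⟩ := hf.exists_step hG hω h
    exact ⟨_, hs.map g, ω', hω', rfl, rfl⟩
  back := by
    rintro _ _ σ' ⟨ω, hω, rfl, rfl⟩ h
    obtain ⟨ω', hs, hω', rfl⟩ := hg.exists_step hG hω h
    exact ⟨_, hs.map f, ω', hω', rfl, rfl⟩

theorem stBisimilar_of_span {f : W ⟶ X.toHDA} {g : W ⟶ Y.toHDA} (hf : LiftsStarts f)
    (hg : LiftsStarts g) (hl : f ≫ X.lab = g ≫ Y.lab) : STBisimilar X Y := by
  refine ⟨SpanRel (fun _ => True) f g, isPathBisimulation_spanRel ?_ ?_ trivial ?_, ?_⟩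
  · intro n x k y _ h
    obtain ⟨x', h, h'⟩ := hf n x k y h
    exact ⟨x', trivial, h, h'⟩
  · intro n x k y _ h
    obtain ⟨x', h, h'⟩ := hg n x k y h
    exact ⟨x', trivial, h, h'⟩
  · exact fun _ _ _ _ => trivial
  · rintro _ _ ⟨ω, _, rfl, rfl⟩
    exact stTrace_map_eq hl ω.path

/-- A homotopy bisimulation, viewed as a span of precubical morphisms from an unfolding. -/
theorem HomotopyBisimilar.exists_span (h : HomotopyBisimilar X Y) :
    ∃ (W : HDA.{u}) (f : W ⟶ X.toHDA) (g : W ⟶ Y.toHDA), LiftsStarts f ∧ LiftsStarts g ∧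
      f ≫ X.lab = g ≫ Y.lab := by
  obtain ⟨Z, f, g, hf, hg, hf', hg'⟩ := h
  have hf'' := (HDAh.isOpen_iff.1 hf').comp (liftsStarts_proj (X := X.toHDA))
  have hg'' := (HDAh.isOpen_iff.1 hg').comp (liftsStarts_proj (X := Y.toHDA))
  refine ⟨unfold Z.toHDA, _, _, hf'', hg'', ?_⟩
  rw [Category.assoc, Category.assoc, ← unfoldMap_proj, ← unfoldMap_proj, ← Category.assoc,
    ← Category.assoc]
  exact congrArg (· ≫ proj (torus S)) (hf.trans hg.symm)

theorem HomotopyBisimilar.stBisimilar (h : HomotopyBisimilar X Y) : STBisimilar X Y := by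
  obtain ⟨W, f, g, hf, hg, hl⟩ := h.exists_span
  exact stBisimilar_of_span hf hg hl

/-- A label-preserving morphism of HDA that lifts cubes along lower faces is a homotopy bisimulation. -/
theorem homotopyBisimilar_of_liftsStarts {f : X.toHDA ⟶ Y.toHDA} (hf : LiftsStarts f)
    (hl : f ≫ Y.lab = X.lab) : HomotopyBisimilar X Y := by
  refine ⟨X, 𝟙 _, InducedCategory.homMk (unfoldMap f), unfold_hom_ext rfl, ?_, ?_, ?_⟩
  · exact (unfoldMap_comp f Y.lab).symm.trans (congrArg unfoldMap hl)
  · exact HDAh.isOpen_iff.2 fun n x k y h => ⟨y, h, rfl⟩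
  · exact HDAh.isOpen_iff.2 hf.unfoldMap

theorem historyPreservingBisimilar_of_span {G : ∀ {n : ℕ}, W.cell n → Prop} {f : W ⟶ X.toHDA}
    {g : W ⟶ Y.toHDA} (hf : LiftsStartsOn G f) (hg : LiftsStartsOn G g) (hpt : G W.pt)
    (hG : ∀ (n : ℕ) (w : W.cell (n + 1)) (k : Fin (n + 1)), G w → G (W.δ k true w))
    (hf' : LiftsBetween f) (hg' : LiftsBetween g) (hl : f ≫ X.lab = g ≫ Y.lab) :
    HistoryPreservingBisimilar X Y := by
  refine ⟨_, isPathBisimulation_spanRel hf hg hpt hG, ?_, ?_, ?_⟩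
  · rintro _ _ ⟨ω, _, rfl, rfl⟩
    exact stTrace_map_eq hl ω.path
  · rintro p _ _ _ ⟨ω, hω, rfl, rfl⟩ h
    obtain ⟨ω', hωω', rfl⟩ := hf'.exists_adjAt h
    exact ⟨_, hωω'.map g, ω', by cases hωω'; exact hω, rfl, rfl⟩
  · rintro p _ _ _ ⟨ω, hω, rfl, rfl⟩ h
    obtain ⟨ω', hωω', rfl⟩ := hg'.exists_adjAt h
    exact ⟨_, hωω'.map f, ω', by cases hωω'; exact hω, rfl, rfl⟩

/-! ### Split bisimilarity from cubes -/

/-- Split bisimilarity only depends on the last cubes of paths: it follows from a bisimulation between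
the cubes of the two HDA, regarded as the states of a transition system labelled with split actions. -/
theorem splitBisimilar_of_cells (R : ∀ {n : ℕ}, X.cell n → Y.cell n → Prop) (hpt : R X.pt Y.pt)
    (hstart : ∀ (n : ℕ) (x : X.cell n) (y : Y.cell n) (k : Fin (n + 1)) (x' : X.cell (n + 1)),
      R x y → X.δ k false x' = x → ∃ (l : Fin (n + 1)) (y' : Y.cell (n + 1)),
        Y.δ l false y' = y ∧ (X.lab.map x').1 k = (Y.lab.map y').1 l ∧ R x' y')
    (hstart' : ∀ (n : ℕ) (x : X.cell n) (y : Y.cell n) (k : Fin (n + 1)) (y' : Y.cell (n + 1)),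
      R x y → Y.δ k false y' = y → ∃ (l : Fin (n + 1)) (x' : X.cell (n + 1)),
        X.δ l false x' = x ∧ (X.lab.map x').1 l = (Y.lab.map y').1 k ∧ R x' y')
    (hfinish : ∀ (n : ℕ) (x : X.cell (n + 1)) (y : Y.cell (n + 1)) (k : Fin (n + 1)),
      R x y → ∃ l, (X.lab.map x).1 k = (Y.lab.map y).1 l ∧ R (X.δ k true x) (Y.δ l true y))
    (hfinish' : ∀ (n : ℕ) (x : X.cell (n + 1)) (y : Y.cell (n + 1)) (k : Fin (n + 1)),
      R x y → ∃ l, (X.lab.map x).1 l = (Y.lab.map y).1 k ∧ R (X.δ l true x) (Y.δ k true y)) :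
    SplitBisimilar X Y := by
  refine ⟨fun ρ σ => X.splitTrace ρ.path = Y.splitTrace σ.path ∧ ∃ (n : ℕ) (x : X.cell n)
    (y : Y.cell n) (ρ' : CubePath X.toHDA n x) (σ' : CubePath Y.toHDA n y),
    ρ = ⟨n, x, ρ'⟩ ∧ σ = ⟨n, y, σ'⟩ ∧ R x y, ⟨⟨rfl, _, _, _, _, _, rfl, rfl, hpt⟩, ?_, ?_⟩,
    fun _ _ h => h.1⟩
  · rintro _ _ _ ⟨ht, n, x, y, ρ, σ, rfl, rfl, hR⟩ (⟨_, k, x', h⟩ | ⟨_, k, x', h⟩)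
    · obtain ⟨l, y', h', hl, hR'⟩ := hstart _ x y k x' hR h
      refine ⟨_, .start σ l y' h', ?_, _, _, _, _, _, rfl, rfl, hR'⟩
      exact congrArg₂ (· ++ [·]) ht (congrArg _ hl)
    · obtain ⟨l, hl, hR'⟩ := hfinish _ _ y k hR
      refine ⟨_, .finish σ l _ rfl, ?_, _, _, _, _, _, rfl, rfl, h ▸ hR'⟩
      exact congrArg₂ (· ++ [·]) ht (congrArg _ hl)
  · rintro _ _ _ ⟨ht, n, x, y, ρ, σ, rfl, rfl, hR⟩ (⟨_, k, y', h⟩ | ⟨_, k, y', h⟩)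
    · obtain ⟨l, x', h', hl, hR'⟩ := hstart' _ x y k y' hR h
      refine ⟨_, .start ρ l x' h', ?_, _, _, _, _, _, rfl, rfl, hR'⟩
      exact congrArg₂ (· ++ [·]) ht (congrArg _ hl)
    · obtain ⟨l, hl, hR'⟩ := hfinish' _ x _ k hR
      refine ⟨_, .finish ρ l _ rfl, ?_, _, _, _, _, _, rfl, rfl, h ▸ hR'⟩
      exact congrArg₂ (· ++ [·]) ht (congrArg _ hl)

end LHDA

namespace SquareData

open HDA LHDA

variable {S : Type} [LinearOrder S] (D D' : SquareData S)

/-! ### Two-dimensional HDA -/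

/-- The lower face of a square in direction `k`. -/
def lower (k : Fin 2) (s : Fin D.nQ) : Fin D.nE := ![(D.square s).2.1, (D.square s).1] k

/-- The upper face of a square in direction `k`. -/
def upper (k : Fin 2) (s : Fin D.nQ) : Fin D.nE := ![(D.square s).2.2.2, (D.square s).2.2.1] k

/-- The label of a square in direction `k`. -/
def squareLabel (s : Fin D.nQ) (k : Fin 2) : S :=
  ![(D.edge (D.square s).1).2.2, (D.edge (D.square s).2.1).2.2] k

theorem face_false (k : Fin 2) (s : Fin D.nQ) : D.face (n := 1) k false s = D.lower k s := by
  fin_cases k <;> rfl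

theorem face_true (k : Fin 2) (s : Fin D.nQ) : D.face (n := 1) k true s = D.upper k s := by
  fin_cases k <;> rfl

variable {D D'}

theorem toHDA_δ_true_ne {x : Fin D.nE} (h : ∀ k s, D.upper k s ≠ x) (k : Fin 2)
    (s : D.toHDA.cell 2) : D.toHDA.δ (n := 1) k true s ≠ x :=
  fun hs => h k s ((D.face_true k s).symm.trans hs)

/-- To prove a property of the last edge of a path that ends by starting an event with label `l` in the
vertex `x`, it is enough to check the edges with this source and label. -/
theorem forall_edge {x : Fin D.nV} {l : S} {P : Fin D.nE → Prop}
    (h : ∀ y, (D.edge y).1 = x → (D.edge y).2.2 = l → P y) (k : Fin 1) (y : D.toHDA.cell 1)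
    (hy : D.toHDA.δ k false y = x) (hl : (D.toLHDA.lab.map y).1 k = l) : P y := by
  obtain rfl : k = 0 := Subsingleton.elim _ _
  exact h y hy hl

theorem forall_square {x : Fin D.nE} {l : S} {P : Fin 2 → Fin D.nQ → Prop}
    (h : ∀ k s, D.lower k s = x → D.squareLabel s k = l → P k s) (k : Fin 2)
    (s : D.toHDA.cell 2) (hs : D.toHDA.δ (n := 1) k false s = x)
    (hl : (D.toLHDA.lab.map s).1 k = l) : P k s :=
  h k s ((D.face_false k s).symm.trans hs) hl

theorem forall_square_label {l₀ l₁ : S} {P : Fin D.nQ → Prop}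
    (h : ∀ s, D.squareLabel s 0 = l₀ → D.squareLabel s 1 = l₁ → P s) (s : D.toHDA.cell 2)
    (h₀ : (D.toLHDA.lab.map s).1 0 = l₀) (h₁ : (D.toLHDA.lab.map s).1 1 = l₁) : P s := h s h₀ h₁

/-- A map on cubes, given by maps on vertices, edges and squares. -/
def cellMap {T : ℕ → Type} (v : Fin D.nV → T 0) (e : Fin D.nE → T 1) (q : Fin D.nQ → T 2) :
    ∀ {n : ℕ}, D.Cell n → T n
  | 0, x => v x
  | 1, x => e x
  | 2, x => q x
  | _ + 3, x => x.elim

theorem cellMap_face_true {Gv : Fin D.nV → Prop} {Ge : Fin D.nE → Prop}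
    (he : ∀ x, Ge x → Gv (D.edge x).2.1) (hs : ∀ k s, Ge (D.upper k s)) {n : ℕ}
    (x : D.Cell (n + 1)) (k : Fin (n + 1))
    (hx : cellMap (T := fun _ => Prop) Gv Ge (fun _ => True) x) :
    cellMap (T := fun _ => Prop) Gv Ge (fun _ => True) (D.face k true x) := by
  match n, x, k with
  | 0, x, _ => exact he x hx
  | 1, s, k => exact (congrArg Ge (D.face_true k s)).mpr (hs k s)
  | _ + 2, s, _ => exact s.elim

/-- The label-preserving morphism given by maps on vertices, edges and squares. -/
def hom (v : Fin D.nV → Fin D'.nV) (e : Fin D.nE → Fin D'.nE) (q : Fin D.nQ → Fin D'.nQ)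
    (hv : v D.init = D'.init)
    (he : ∀ x, D'.edge (e x) = (v (D.edge x).1, v (D.edge x).2.1, (D.edge x).2.2))
    (hq : ∀ s, D'.square (q s) = (e (D.square s).1, e (D.square s).2.1, e (D.square s).2.2.1,
      e (D.square s).2.2.2)) : D.toHDA ⟶ D'.toHDA where
  map := cellMap (T := D'.Cell) v e q
  map_δ {n} k ν x := by
    match n, k, ν, x with
    | 0, _, false, x => exact (congrArg (·.1) (he x)).symm
    | 0, _, true, x => exact (congrArg (·.2.1) (he x)).symm
    | 1, 0, false, s => exact (congrArg (·.2.1) (hq s)).symm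
    | 1, 0, true, s => exact (congrArg (·.2.2.2) (hq s)).symm
    | 1, 1, false, s => exact (congrArg (·.1) (hq s)).symm
    | 1, 1, true, s => exact (congrArg (·.2.2.1) (hq s)).symm
    | _ + 2, _, _, s => exact s.elim
  map_pt := hv

section hom

variable {v : Fin D.nV → Fin D'.nV} {e : Fin D.nE → Fin D'.nE} {q : Fin D.nQ → Fin D'.nQ} {hv he hq}

theorem hom_lab : (hom v e q hv he hq) ≫ D'.toLHDA.lab = D.toLHDA.lab := by
  refine hom_ext fun n x => Subtype.ext (funext fun i => ?_)
  match n, x, i with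
  | 1, x, i =>
    obtain rfl : i = 0 := Fin.ext (by omega)
    exact congrArg (·.2.2) (he x)
  | 2, s, 0 =>
    exact (congrArg (fun t => (D'.edge t.1).2.2) (hq s)).trans (congrArg (·.2.2) (he _))
  | 2, s, 1 =>
    exact (congrArg (fun t => (D'.edge t.2.1).2.2) (hq s)).trans (congrArg (·.2.2) (he _))
  | _ + 3, s, _ => exact s.elim

theorem liftsStartsOn_hom {Gv : Fin D.nV → Prop} {Ge : Fin D.nE → Prop}
    (h₀ : ∀ x, Gv x → ∀ y, (D'.edge y).1 = v x → ∃ x', Ge x' ∧ (D.edge x').1 = x ∧ e x' = y)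
    (h₁ : ∀ x, Ge x → ∀ k y, D'.lower k y = e x → ∃ x', D.lower k x' = x ∧ q x' = y) :
    LiftsStartsOn (cellMap (T := fun _ => Prop) Gv Ge fun _ => True) (hom v e q hv he hq) := by
  intro n x k y hx h
  match n, x, k, y with
  | 0, x, _, y => exact h₀ x hx y h
  | 1, x, k, y =>
    obtain ⟨x', h, h'⟩ := h₁ x hx k y ((D'.face_false k y).symm.trans h)
    exact ⟨x', trivial, (D.face_false k x').trans h, h'⟩
  | _ + 2, _, _, y => exact y.elim

theorem liftsBetween_hom (h : ∀ v w, (D.edge v).2.1 = (D.edge w).1 → ∀ k l y,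
      D'.lower k y = e v → D'.upper l y = e w → ∃ x, D.lower k x = v ∧ D.upper l x = w ∧ q x = y) :
    LiftsBetween (hom v e q hv he hq) := by
  intro n v w _ _ k l y h₀ h₁ h₂
  match n, v, w, k, l, y with
  | 0, v, w, k, l, y =>
    obtain ⟨x, h₁, h₂, h₃⟩ := h v w h₀ k l y ((D'.face_false k y).symm.trans h₁)
      ((D'.face_true l y).symm.trans h₂)
    exact ⟨x, (D.face_false k x).trans h₁, (D.face_true l x).trans h₂, h₃⟩
  | _ + 1, _, _, _, _, y => exact y.elim

end hom

/-- Split bisimilarity from a common classification of the cubes, by functions `v`, `e` and `q` for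
one HDA and `v'`, `e'` and `q'` for the other. -/
theorem splitBisimilar_of_classes (v : Fin D.nV → ℕ) (e : Fin D.nE → ℕ) (q : Fin D.nQ → ℕ)
    (v' : Fin D'.nV → ℕ) (e' : Fin D'.nE → ℕ) (q' : Fin D'.nQ → ℕ)
    (hpt : v D.init = v' D'.init)
    (hv : ∀ x y, v x = v' y → ∀ x', (D.edge x').1 = x →
      ∃ y', (D'.edge y').1 = y ∧ (D.edge x').2.2 = (D'.edge y').2.2 ∧ e x' = e' y')
    (hv' : ∀ x y, v x = v' y → ∀ y', (D'.edge y').1 = y →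
      ∃ x', (D.edge x').1 = x ∧ (D.edge x').2.2 = (D'.edge y').2.2 ∧ e x' = e' y')
    (he : ∀ x y, e x = e' y →
      (D.edge x).2.2 = (D'.edge y).2.2 ∧ v (D.edge x).2.1 = v' (D'.edge y).2.1)
    (hs : ∀ x y, e x = e' y → ∀ k s, D.lower k s = x →
      ∃ l s', D'.lower l s' = y ∧ D.squareLabel s k = D'.squareLabel s' l ∧ q s = q' s')
    (hs' : ∀ x y, e x = e' y → ∀ k s', D'.lower k s' = y →
      ∃ l s, D.lower l s = x ∧ D.squareLabel s l = D'.squareLabel s' k ∧ q s = q' s')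
    (hq : ∀ s s', q s = q' s' → ∀ k, ∃ l, D.squareLabel s k = D'.squareLabel s' l ∧
      e (D.upper k s) = e' (D'.upper l s'))
    (hq' : ∀ s s', q s = q' s' → ∀ k, ∃ l, D.squareLabel s l = D'.squareLabel s' k ∧
      e (D.upper l s) = e' (D'.upper k s')) :
    SplitBisimilar D.toLHDA D'.toLHDA := by
  refine splitBisimilar_of_cells (fun {n} x y => cellMap (T := fun _ => ℕ) v e q (n := n) x =
    cellMap (T := fun _ => ℕ) v' e' q' (n := n) y) hpt ?_ ?_ ?_ ?_
  · intro n x y k x' h hx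
    match n, x, y, k, x' with
    | 0, x, y, 0, x' =>
      obtain ⟨y', h₁, h₂, h₃⟩ := hv x y h x' hx
      exact ⟨0, y', h₁, h₂, h₃⟩
    | 1, x, y, k, s =>
      obtain ⟨l, s', h₁, h₂, h₃⟩ := hs x y h k s ((D.face_false k s).symm.trans hx)
      exact ⟨l, s', (D'.face_false l s').trans h₁, h₂, h₃⟩
    | _ + 2, _, _, _, s => exact s.elim
  · intro n x y k y' h hy
    match n, x, y, k, y' with
    | 0, x, y, 0, y' =>
      obtain ⟨x', h₁, h₂, h₃⟩ := hv' x y h y' hy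
      exact ⟨0, x', h₁, h₂, h₃⟩
    | 1, x, y, k, s =>
      obtain ⟨l, s', h₁, h₂, h₃⟩ := hs' x y h k s ((D'.face_false k s).symm.trans hy)
      exact ⟨l, s', (D.face_false l s').trans h₁, h₂, h₃⟩
    | _ + 2, _, _, _, s => exact s.elim
  · intro n x y k h
    match n, x, y, k with
    | 0, x, y, 0 => exact ⟨0, he x y h⟩
    | 1, s, s', k =>
      obtain ⟨l, h₁, h₂⟩ := hq s s' h k
      refine ⟨l, h₁, ?_⟩
      exact (congrArg e (D.face_true k s)).trans (h₂.trans (congrArg e' (D'.face_true l s')).symm)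
    | _ + 2, s, _, _ => exact s.elim
  · intro n x y k h
    match n, x, y, k with
    | 0, x, y, 0 => exact ⟨0, he x y h⟩
    | 1, s, s', k =>
      obtain ⟨l, h₁, h₂⟩ := hq' s s' h k
      refine ⟨l, h₁, ?_⟩
      exact (congrArg e (D.face_true l s)).trans (h₂.trans (congrArg e' (D'.face_true k s')).symm)
    | _ + 2, s, _, _ => exact s.elim

end SquareData

namespace Example

open HDA LHDA SquareData

/-! ### The first example -/

/-- Folding the branch of `X₁` onto the square. -/
def fold₁ : X₁.toHDA ⟶ X₁'.toHDA :=
  SquareData.hom ![0, 1, 2, 3, 3] ![0, 1, 2, 2, 3] ![0] (by decide) (by decide) (by decide)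

theorem homotopyBisimilar_X₁ : HomotopyBisimilar X₁ X₁' := by
  have h : LiftsStartsOn _ fold₁ := SquareData.liftsStartsOn_hom (Gv := fun _ => True)
    (Ge := fun _ => True) (by decide) (by decide)
  refine homotopyBisimilar_of_liftsStarts (f := fold₁) (h.liftsStarts fun n x => ?_)
    SquareData.hom_lab
  exact match n, x with
    | 0, _ => trivial
    | 1, _ => trivial
    | 2, _ => trivial

/-- The path in `X₁` that executes `a` and then `b` in the branch. -/
def branch₁ : CubePath X₁.toHDA 1 (2 : Fin 5) :=
  let ρ₁ : CubePath X₁.toHDA 1 (0 : Fin 5) := .start .nil 0 _ rfl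
  let ρ₂ : CubePath X₁.toHDA 0 (1 : Fin 5) := .finish ρ₁ 0 _ rfl
  .start ρ₂ 0 _ rfl

/-- The last edge of `branch₁` is not an upper face of a square, so that the end of `a` and the start of `b`
cannot be exchanged. -/
theorem not_adjAt_branch₁ {p : ℕ} {τ ρ : Path X₁.toHDA} (hp : 1 = p)
    (hτ : (⟨1, _, branch₁⟩ : Path X₁.toHDA) = τ) : ¬ Path.AdjAt p τ ρ := by
  intro h
  have hl : τ.path.length = 3 := by rw [← hτ]; rfl
  unfold branch₁ at hτ
  obtain ⟨h | h⟩ := h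
  · cases h with
    | startStart => cases hτ
    | finishFinish => cases hτ
    | startFinish _ _ _ _ _ _ _ _ _ _ h₄ =>
      cases hτ
      exact SquareData.toHDA_δ_true_ne (by decide) _ _ (h₄ : _ = (2 : Fin 5))
    | startFinish' _ _ _ _ _ _ _ _ _ _ h₄ =>
      cases hτ
      exact SquareData.toHDA_δ_true_ne (by decide) _ _ (h₄ : _ = (2 : Fin 5))
    | congrStart h =>
      have := h.add_two_le_length.1
      simp only [CubePath.length] at hl
      omega
    | congrFinish h => cases hτ
  · cases h with
    | startStart => cases hτ
    | finishFinish => cases hτ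
    | startFinish => cases hτ
    | startFinish' => cases hτ
    | congrStart h =>
      have := h.add_two_le_length.2
      simp only [CubePath.length] at hl
      omega
    | congrFinish h => cases hτ

theorem not_historyPreservingBisimilar_X₁ : ¬ HistoryPreservingBisimilar X₁ X₁' := by
  rintro ⟨R, hR, ht, -, hadj⟩
  obtain ⟨σ, hσ⟩ : ∃ σ, R ⟨1, _, branch₁⟩ σ := hR.exists_related branch₁
  have hT : X₁'.stTrace σ.path = [.start a, .finish a 0, .start b] := (ht _ _ hσ).symm.trans rfl
  obtain ⟨_, y₂, σ₂, k₃, y₃, h₃, rfl, t₂, l₃⟩ := eq_start_of_stTrace (T := [_, _]) hT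
  obtain ⟨_, y₁, σ₁, k₂, _, h₂, e₂, t₁, -⟩ := eq_finish_of_stTrace (T := [_]) t₂
  cases e₂
  obtain ⟨_, y₀, σ₀, k₁, _, h₁, e₁, t₀, l₁⟩ := eq_start_of_stTrace (T := []) t₁
  cases e₁
  cases eq_nil_of_stTrace t₀
  obtain rfl : k₁ = 0 := Fin.fin_one_eq_zero k₁
  obtain rfl : k₂ = 0 := Fin.fin_one_eq_zero k₂
  obtain rfl : k₃ = 0 := Fin.fin_one_eq_zero k₃
  obtain rfl : y₁ = (0 : Fin 4) :=
    SquareData.forall_edge (P := (· = (0 : Fin 4))) (by decide) _ _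
      (show _ = (0 : Fin 4) from h₁) l₁
  subst h₂
  obtain rfl : y₃ = (2 : Fin 4) :=
    SquareData.forall_edge (P := (· = (2 : Fin 4))) (by decide) _ _
      (show _ = (1 : Fin 4) from h₃) l₃
  -- the adjacent path through the square
  let σ₁ : CubePath X₁'.toHDA 1 (0 : Fin 4) := .start .nil 0 _ rfl
  let σ₂ : CubePath X₁'.toHDA 2 (0 : Fin 1) := .start σ₁ 1 _ rfl
  let σ₃ : CubePath X₁'.toHDA 1 (2 : Fin 4) := .finish σ₂ 0 _ rfl
  obtain ⟨ρ, hρ, -⟩ := hadj 1 _ _ ⟨1, _, σ₃⟩ hσ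
    (.mk (.inl (.startFinish' σ₁ 0 0 le_rfl _ (0 : Fin 1) _ rfl rfl rfl rfl)))
  exact not_adjAt_branch₁ rfl rfl hρ

/-! ### The second example -/

/-- `X₂'` together with two copies of the last square of `X₂`. -/
abbrev D₂ : SquareData Letter :=
  { nV := 17, nE := 22, nQ := 6, init := 0
    edge := ![(0, 1, c), (0, 2, b), (0, 3, a), (1, 4, b), (2, 4, c), (2, 5, a), (3, 5, b),
      (0, 6, c), (0, 7, a), (0, 8, b), (6, 9, a), (7, 9, c), (7, 10, b), (8, 10, a),
      (0, 11, a), (0, 12, b), (11, 13, b), (12, 13, a),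
      (0, 14, a), (0, 15, b), (14, 16, b), (15, 16, a)]
    square := ![(1, 0, 3, 4), (2, 1, 5, 6), (8, 7, 10, 11), (8, 9, 13, 12), (14, 15, 17, 16),
      (18, 19, 21, 20)]
    corner₀₀ := by decide
    corner₁₀ := by decide
    corner₀₁ := by decide
    corner₁₁ := by decide
    label₁ := by decide
    label₂ := by decide
    sorted := by decide }

/-- Identification of the two copies. -/
def left₂ : D₂.toHDA ⟶ X₂.toHDA :=
  SquareData.hom ![0, 1, 2, 3, 4, 5, 6, 7, 8, 9, 10, 11, 12, 13, 11, 12, 13]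
    ![0, 1, 2, 3, 4, 5, 6, 7, 8, 9, 10, 11, 12, 13, 14, 15, 16, 17, 14, 15, 16, 17]
    ![0, 1, 2, 3, 4, 4] (by decide) (by decide) (by decide)

/-- Identification of the two copies with the two `ab`-squares of `X₂'`. -/
def right₂ : D₂.toHDA ⟶ X₂'.toHDA :=
  SquareData.hom ![0, 1, 2, 3, 4, 5, 6, 7, 8, 9, 10, 3, 2, 5, 7, 8, 10]
    ![0, 1, 2, 3, 4, 5, 6, 7, 8, 9, 10, 11, 12, 13, 2, 1, 6, 5, 8, 9, 12, 13]
    ![0, 1, 2, 3, 1, 3] (by decide) (by decide) (by decide)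

/-- Paths into the first copy of the additional square are related to their images once they have started `a`,
paths into the second copy once they have started `b`. So the cubes of the first copy with `a` still to
be started, edge `15` and vertex `12`, and those of the second copy with `b` still to be
started, edge `18` and vertex `14`, are left out. -/
theorem historyPreservingBisimilar_X₂ : HistoryPreservingBisimilar X₂ X₂' := by
  refine historyPreservingBisimilar_of_span (W := D₂.toHDA)
    (G := cellMap (D := D₂) (T := fun _ => Prop) (fun x => x.val ≠ 12 ∧ x.val ≠ 14)
      (fun x => x.val ≠ 15 ∧ x.val ≠ 18) fun _ => True) (f := left₂) (g := right₂)
    (liftsStartsOn_hom (by decide) (by decide)) (liftsStartsOn_hom (by decide) (by decide))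
    ?_ (fun n => cellMap_face_true (by decide) (by decide))
    (liftsBetween_hom (by decide)) (liftsBetween_hom (by decide)) ?_
  · exact ⟨by decide, by decide⟩
  · exact hom_lab.trans hom_lab.symm

/-- The additional square of `X₂` is lifted to the span, together with its lower faces, and the image of
the lift in `X₂'` is considered. -/
theorem not_homotopyBisimilar_X₂ : ¬ HomotopyBisimilar X₂ X₂' := by
  intro h
  obtain ⟨W, f, g, hf, hg, hl⟩ := h.exists_span
  have hl : ∀ w : W.cell 2, X₂.lab.map (f.map w) = X₂'.lab.map (g.map w) := fun w =>
    congrArg (fun t : W ⟶ torus Letter => t.map w) hl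
  obtain ⟨w, -, hw⟩ := hf 0 W.pt 0 (14 : Fin 18) (Hom.map_pt f).symm
  obtain ⟨s, hs, hs'⟩ := hf 1 w 1 (4 : Fin 5) hw.symm
  -- the image of the lift `s` in `X₂'` is one of the two squares with labels `a` and `b`
  have hlab : X₂'.lab.map (g.map s) = X₂.lab.map (X := X₂.toHDA) (n := 2) (4 : Fin 5) := by
    rw [← hl, hs']
  have h₀ : (X₂'.lab.map (g.map s)).1 0 = a := by rw [hlab]; rfl
  have h₁ : (X₂'.lab.map (g.map s)).1 1 = b := by rw [hlab]; rfl
  have hsq : g.map s = (1 : Fin 4) ∨ g.map s = (3 : Fin 4) :=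
    SquareData.forall_square_label (P := fun t => t = (1 : Fin 4) ∨ t = (3 : Fin 4)) (by decide) _
      h₀ h₁
  obtain hsq | hsq := hsq
  · -- the lower `b`-edge of `s` admits an extension to a `bc`-square in `X₂'`, but not in `X₂`
    have hg' : X₂'.δ (n := 1) 1 false (0 : Fin 4) = g.map (W.δ 0 false s) := by
      rw [Hom.map_δ, hsq]; rfl
    obtain ⟨t, ht, ht'⟩ := hg 1 _ 1 (0 : Fin 4) hg'
    have hft : X₂.δ (n := 1) 1 false (f.map t) = (15 : Fin 18) := by
      rw [← Hom.map_δ, ht, Hom.map_δ, hs']; rfl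
    have hc : (X₂.lab.map (f.map t)).1 1 = c := by rw [hl, ht']; rfl
    exact SquareData.forall_square (P := fun _ _ => False) (by decide) _ _
      (show _ = (15 : Fin 18) from hft) hc
  · -- the lower `a`-edge of `s` admits an extension to an `ac`-square in `X₂'`, but not in `X₂`
    have hg' : X₂'.δ (n := 1) 1 false (2 : Fin 4) = g.map (W.δ 1 false s) := by
      rw [Hom.map_δ, hsq]; rfl
    obtain ⟨t, ht, ht'⟩ := hg 1 _ 1 (2 : Fin 4) hg'
    have hft : X₂.δ (n := 1) 1 false (f.map t) = (14 : Fin 18) := by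
      rw [← Hom.map_δ, ht, Hom.map_δ, hs']; rfl
    have hc : (X₂.lab.map (f.map t)).1 1 = c := by rw [hl, ht']; rfl
    exact SquareData.forall_square (P := fun _ _ => False) (by decide) _ _
      (show _ = (14 : Fin 18) from hft) hc

/-! ### The third example -/

/-- Equal numbers mark bisimilar cubes. The two upper edges `11` and `12` of the `cc`-square of `X₃` are
matched with the edges `12` and `11` of `X₃'`, in this order, and each of the squares labelled `cd` or `ce`
in the middle with one in a wing, so that `d` and `e` agree. -/
theorem splitBisimilar_X₃ : SplitBisimilar X₃ X₃' :=
  SquareData.splitBisimilar_of_classes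
    ![0, 1, 2, 3, 4, 5, 6, 6, 7, 8, 9, 10, 11, 12, 9, 8, 11, 10, 12, 7, 8, 10, 11, 12]
    ![0, 1, 2, 3, 4, 5, 6, 7, 7, 8, 9, 10, 11, 12, 13, 14, 15, 16, 17, 18, 12, 11, 16, 15, 14, 18,
      17, 9, 10, 13, 14, 15, 17, 18]
    ![0, 1, 2, 3, 4, 5, 6, 5, 6, 4, 6]
    ![0, 1, 2, 3, 4, 5, 6, 6, 9, 8, 7, 11, 10, 12, 7, 8, 10, 11, 12, 9, 8, 11, 10, 12]
    ![0, 1, 2, 3, 4, 5, 6, 7, 7, 8, 12, 11, 10, 9, 16, 15, 14, 13, 18, 17, 9, 10, 13, 14, 15, 17,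
      18, 12, 11, 16, 15, 14, 18, 17]
    ![0, 1, 2, 3, 5, 4, 6, 4, 6, 5, 6]
    (by decide +kernel) (by decide +kernel) (by decide +kernel) (by decide +kernel)
    (by decide +kernel) (by decide +kernel) (by decide +kernel) (by decide +kernel)

/-- In `X₃` there is a path that executes `a`, then starts `b` and, while `b` is running, a first `c`; ends
`b`, starts a second `c`, ends the first `c` and starts `d`. The ST-trace of this path determines the
path to be followed in `X₃'` up to the end of the first `c`, and there only `e` can be started. -/
theorem not_stBisimilar_X₃ : ¬ STBisimilar X₃ X₃' := by
  intro h
  let ρ₁ : CubePath X₃.toHDA 1 (0 : Fin 34) := .start .nil 0 _ rfl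
  let ρ₂ : CubePath X₃.toHDA 0 (1 : Fin 24) := .finish ρ₁ 0 _ rfl
  let ρ₃ : CubePath X₃.toHDA 1 (3 : Fin 34) := .start ρ₂ 0 _ rfl
  let ρ₄ : CubePath X₃.toHDA 2 (1 : Fin 11) := .start ρ₃ 1 _ rfl
  let ρ₅ : CubePath X₃.toHDA 1 (7 : Fin 34) := .finish ρ₄ 0 _ rfl
  let ρ₆ : CubePath X₃.toHDA 2 (3 : Fin 11) := .start ρ₅ 1 _ rfl
  let ρ₇ : CubePath X₃.toHDA 1 (11 : Fin 34) := .finish ρ₆ 0 _ rfl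
  let ρ₈ : CubePath X₃.toHDA 2 (4 : Fin 11) := .start ρ₇ 1 _ rfl
  obtain ⟨σ, hσ⟩ := h.exists_stTrace_eq ρ₈
  have hT : X₃'.stTrace σ.path = [.start a, .finish a 0, .start b, .start c, .finish b 2, .start c,
    .finish c 3, .start d] := hσ.trans rfl
  clear hσ
  obtain ⟨_, y₇, σ₇, k₈, y₈, h₈, rfl, t₇, l₈⟩ := eq_start_of_stTrace (T := [_, _, _, _, _, _, _]) hT
  obtain ⟨_, y₆, σ₆, k₇, _, h₇, e₇, t₆, l₇, s₇⟩ :=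
    eq_finish_of_stTrace (T := [_, _, _, _, _, _]) t₇
  cases e₇
  obtain ⟨_, y₅, σ₅, k₆, _, h₆, e₆, t₅, l₆⟩ := eq_start_of_stTrace (T := [_, _, _, _, _]) t₆
  cases e₆
  obtain ⟨_, y₄, σ₄, k₅, _, h₅, e₅, t₄, l₅, s₅⟩ := eq_finish_of_stTrace (T := [_, _, _, _]) t₅
  cases e₅
  obtain ⟨_, _, σ₃, k₄, _, h₄, e₄, t₃, l₄⟩ := eq_start_of_stTrace (T := [_, _, _]) t₄
  cases e₄
  obtain ⟨_, y₂, σ₂, k₃, y₃, h₃, e₃, t₂, l₃⟩ := eq_start_of_stTrace (T := [_, _]) t₃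
  cases e₃
  obtain ⟨_, y₁, σ₁, k₂, _, h₂, e₂, t₁, l₂, s₂⟩ := eq_finish_of_stTrace (T := [_]) t₂
  cases e₂
  obtain ⟨_, y₀, σ₀, k₁, _, h₁, e₁, t₀, l₁⟩ := eq_start_of_stTrace (T := []) t₁
  cases e₁
  cases eq_nil_of_stTrace t₀
  clear hT t₇ t₆ t₅ t₄ t₃ t₂ t₁ t₀
  obtain rfl : k₁ = 0 := Fin.fin_one_eq_zero k₁
  obtain rfl : k₂ = 0 := Fin.fin_one_eq_zero k₂
  obtain rfl : k₃ = 0 := Fin.fin_one_eq_zero k₃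
  obtain rfl : y₁ = (0 : Fin 34) :=
    SquareData.forall_edge (P := (· = (0 : Fin 34))) (by decide) _ _
      (show _ = (0 : Fin 24) from h₁) l₁
  subst h₂
  obtain rfl : y₃ = (3 : Fin 34) :=
    SquareData.forall_edge (P := (· = (3 : Fin 34))) (by decide) _ _
      (show _ = (1 : Fin 24) from h₃) l₃
  obtain ⟨rfl, rfl⟩ : k₄ = 1 ∧ y₄ = (1 : Fin 11) :=
    SquareData.forall_square (P := fun k s => k = 1 ∧ s = (1 : Fin 11)) (by decide) _ _
      (show _ = (3 : Fin 34) from h₄) l₄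
  obtain rfl : k₅ = 0 := by
    match k₅, s₅ with
    | 0, _ => rfl
    | 1, s₅ => exact absurd (show 3 = 2 from s₅) (by decide)
  subst h₅
  obtain ⟨rfl, rfl⟩ : k₆ = 1 ∧ y₆ = (3 : Fin 11) :=
    SquareData.forall_square (P := fun k s => k = 1 ∧ s = (3 : Fin 11)) (by decide) _ _
      (show _ = (7 : Fin 34) from h₆) l₆
  obtain rfl : k₇ = 0 := by
    match k₇, s₇ with
    | 0, _ => rfl
    | 1, s₇ => exact absurd (show 5 = 3 from s₇) (by decide)
  subst h₇
  exact SquareData.forall_square (P := fun _ _ => False) (by decide) _ _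
      (show _ = (11 : Fin 34) from h₈) l₈

end Example

open LHDA Example in
theorem mainTheorem8 :
    -- neither ST-bisimilarity nor split bisimilarity implies homotopy bisimilarity
    (¬ ∀ X Y : LHDA Letter, STBisimilar X Y → HomotopyBisimilar X Y) ∧
    (¬ ∀ X Y : LHDA Letter, SplitBisimilar X Y → HomotopyBisimilar X Y) ∧
    -- homotopy bisimilarity and history-preserving bisimilarity are incomparable
    (¬ ∀ X Y : LHDA Letter, HomotopyBisimilar X Y → HistoryPreservingBisimilar X Y) ∧
    (¬ ∀ X Y : LHDA Letter, HistoryPreservingBisimilar X Y → HomotopyBisimilar X Y) ∧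
    -- the three pairs of HDA that witness this
    (HomotopyBisimilar X₁ X₁' ∧ STBisimilar X₁ X₁' ∧ ¬ HistoryPreservingBisimilar X₁ X₁') ∧
    (HistoryPreservingBisimilar X₂ X₂' ∧ STBisimilar X₂ X₂' ∧ SplitBisimilar X₂ X₂' ∧
      ¬ HomotopyBisimilar X₂ X₂') ∧
    (SplitBisimilar X₃ X₃' ∧ ¬ STBisimilar X₃ X₃' ∧ ¬ HomotopyBisimilar X₃ X₃') := by
  have hp₂ := historyPreservingBisimilar_X₂
  have st₂ := hp₂.stBisimilar
  have split₂ := st₂.splitBisimilar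
  exact ⟨fun h => not_homotopyBisimilar_X₂ (h _ _ st₂),
    fun h => not_homotopyBisimilar_X₂ (h _ _ split₂),
    fun h => not_historyPreservingBisimilar_X₁ (h _ _ homotopyBisimilar_X₁),
    fun h => not_homotopyBisimilar_X₂ (h _ _ hp₂),
    ⟨homotopyBisimilar_X₁, homotopyBisimilar_X₁.stBisimilar, not_historyPreservingBisimilar_X₁⟩,
    ⟨hp₂, st₂, split₂, not_homotopyBisimilar_X₂⟩,
    splitBisimilar_X₃, not_stBisimilar_X₃, fun h => not_stBisimilar_X₃ h.stBisimilar⟩
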